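/- Let $a:[0,1]\to\mathbb R$ be continuous with $a(0)=0$ and $a>0$ on $(0,1]$, and assume that there is $K\in(0,2)$ such that $x\mapsto x^K/a(x)$ is nondecreasing near $x=0$, i.e. on $(0,\varepsilon]$ for some $\varepsilon\in(0,1]$. Consider the real spaces $L^2_{1/a}(0,1)=\{u\in L^2(0,1):\int_0^1 u^2/a\,dx<\infty\}$ and $H^2_{1/a}(0,1)=L^2_{1/a}(0,1)\cap H^2_0(0,1)$, where $H^2_0(0,1)=\{u\in H^2(0,1): u(j)=u'(j)=0,\ j=0,1\}$, and let $\mathcal H_0=H^2_{1/a}(0,1)\times L^2_{1/a}(0,1)$ be endowed with the inner product $$\langle (u,v),(\tilde u,\tilde v)\rangle_{\mathcal H_0}=\int_0^1u''\tilde u''\,dx+\int_0^1\frac{v\tilde v}{a}\,dx .$$ Let $Au=au''''$ on $D(A)=\{u\in H^2_{1/a}(0,1): au''''\in L^2_{1/a}(0,1)\}$ (derivatives in the weak sense on $(0,1)$), and let $\mathcal A(u,v)=(v,-Au)$ on $D(\mathcal A)=D(A)\times H^2_{1/a}(0,1)\subset\mathcal H_0$. Then: 1. $\mathcal A$ is non-positive,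 i.e. $\langle\mathcal A U,U\rangle_{\mathcal H_0}\le 0$ for all $U\in D(\mathcal A)$, and dissipative, i.e. $\|\lambda U-\mathcal A U\|_{\mathcal H_0}\ge\lambda\|U\|_{\mathcal H_0}$ for all $\lambda>0$ and $U\in D(\mathcal A)$; 2. $D(\mathcal A)$ is dense in $\mathcal H_0$; 3. $I-\mathcal A:D(\mathcal A)\to\mathcal H_0$ is surjective; 4. $\mathcal A$ is the infinitesimal generator of a strongly continuous semigroup $(S(t))_{t\ge0}$ of contractions on $\mathcal H_0$. -/

import Mathlib

open MeasureTheory Set Filter Topology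
open scoped NNReal ENNReal ContDiff

noncomputable section

namespace DegenerateBeam

/-! ### Standing assumption on the coefficient -/

/-- `a` is continuous on `[0,1]`, vanishes at `0`, is positive on `(0,1]`, and for some `K ∈ (0,2)`
the function `x ↦ x ^ K / a x` is nondecreasing near `0` (on some interval `(0, ε]`). -/
structure IsDegenerateCoefficient (a : ℝ → ℝ) : Prop where
  continuousOn : ContinuousOn a (Icc 0 1)
  zero : a 0 = 0
  pos : ∀ x ∈ Ioc (0 : ℝ) 1, 0 < a x
  monotone_near_zero : ∃ K ∈ Ioo (0 : ℝ) 2, ∃ ε ∈ Ioc (0 : ℝ) 1,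
    MonotoneOn (fun x : ℝ => x ^ K / a x) (Ioc 0 ε)

/-! ### Weak derivatives on `(0,1)` -/

/-- Lebesgue measure on `(0,1)`. -/
abbrev vol : Measure ℝ := volume.restrict (Ioo 0 1)

/-- `φ ∈ C_c^∞(0,1)`. -/
structure IsTest (φ : ℝ → ℝ) : Prop where
  contDiff : ContDiff ℝ ∞ φ
  hasCompactSupport : HasCompactSupport φ
  tsupport_subset : tsupport φ ⊆ Ioo 0 1

/-- `w` is the `k`-th weak (distributional) derivative of `u` on `(0,1)`. -/
structure IsWeakDeriv (k : ℕ) (u w : ℝ → ℝ) : Prop where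
  left : LocallyIntegrableOn u (Ioo 0 1)
  right : LocallyIntegrableOn w (Ioo 0 1)
  integral_eq : ∀ φ, IsTest φ →
    ∫ x in Ioo (0 : ℝ) 1, u x * iteratedDeriv k φ x
      = (-1) ^ k * ∫ x in Ioo (0 : ℝ) 1, w x * φ x

/-- `f` has a representative (up to a.e. equality on `(0,1)`) that is continuous on `[0,1]` and
vanishes at both endpoints. -/
def HasZeroTrace (f : ℝ → ℝ) : Prop :=
  ∃ F : ℝ → ℝ, ContinuousOn F (Icc 0 1) ∧ f =ᵐ[vol] F ∧ F 0 = 0 ∧ F 1 = 0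

/-- `u ∈ H²₀(0,1)`: `u, u', u'' ∈ L²(0,1)` and `u(j) = u'(j) = 0` for `j = 0, 1`. -/
def MemH20 (u : ℝ → ℝ) : Prop :=
  MemLp u 2 vol ∧ HasZeroTrace u ∧
    (∃ u₁, MemLp u₁ 2 vol ∧ IsWeakDeriv 1 u u₁ ∧ HasZeroTrace u₁) ∧
    ∃ u₂, MemLp u₂ 2 vol ∧ IsWeakDeriv 2 u u₂

/-! ### Basic facts on test functions and weak derivatives -/

theorem IsTest.add {φ ψ : ℝ → ℝ} (hφ : IsTest φ) (hψ : IsTest ψ) : IsTest (φ + ψ) where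
  contDiff := hφ.contDiff.add hψ.contDiff
  hasCompactSupport := hφ.hasCompactSupport.add hψ.hasCompactSupport
  tsupport_subset := (tsupport_add φ ψ).trans
    (union_subset hφ.tsupport_subset hψ.tsupport_subset)

theorem IsTest.const_mul {φ : ℝ → ℝ} (hφ : IsTest φ) (c : ℝ) : IsTest (fun x => c * φ x) where
  contDiff := contDiff_const.mul hφ.contDiff
  hasCompactSupport := hφ.hasCompactSupport.mul_left
  tsupport_subset := (tsupport_mul_subset_right (f := fun _ => c) (g := φ)).trans
    hφ.tsupport_subset

theorem IsTest.iteratedDeriv {φ : ℝ → ℝ} (hφ : IsTest φ) (k : ℕ) :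
    IsTest (iteratedDeriv k φ) := by
  induction k with
  | zero => simpa using hφ
  | succ k ih =>
    rw [iteratedDeriv_succ]
    exact ⟨(contDiff_infty_iff_deriv.1 ih.contDiff).2, ih.hasCompactSupport.deriv,
      tsupport_deriv_subset.trans ih.tsupport_subset⟩

theorem IsTest.integrable_mul {f φ : ℝ → ℝ} (hf : LocallyIntegrableOn f (Ioo 0 1))
    (hφ : IsTest φ) : Integrable (fun x => f x * φ x) vol := by
  have h1 : IntegrableOn f (tsupport φ) :=
    hf.integrableOn_compact_subset hφ.tsupport_subset hφ.hasCompactSupport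
  have h2 : IntegrableOn (fun x => f x * φ x) (tsupport φ) :=
    h1.mul_continuousOn hφ.contDiff.continuous.continuousOn hφ.hasCompactSupport
  have h3 : Integrable (fun x => f x * φ x) volume := by
    rw [← integrableOn_iff_integrable_of_support_subset (s := tsupport φ)]
    · exact h2
    · intro x hx
      apply subset_tsupport
      intro h0
      exact hx (by simp [h0])
  exact h3.restrict

theorem ae_eq_zero_of_test {f : ℝ → ℝ} (hf : LocallyIntegrableOn f (Ioo 0 1))
    (h : ∀ φ, IsTest φ → ∫ x in Ioo (0 : ℝ) 1, f x * φ x = 0) : f =ᵐ[vol] 0 := by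
  have := isOpen_Ioo.ae_eq_zero_of_integral_contDiff_smul_eq_zero hf (fun g h1 h2 h3 => by
    have h0 := h g ⟨h1, h2, h3⟩
    rw [setIntegral_eq_integral_of_forall_compl_eq_zero] at h0
    · rw [← h0]
      exact integral_congr_ae (ae_of_all _ fun x => by simp [mul_comm])
    · intro x hx
      have : g x = 0 := by
        by_contra hne
        exact hx (h3 (subset_tsupport g hne))
      simp [this])
  rw [EventuallyEq, ae_restrict_iff' measurableSet_Ioo]
  exact this

theorem IsWeakDeriv.unique {k : ℕ} {u w w' : ℝ → ℝ} (h : IsWeakDeriv k u w)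
    (h' : IsWeakDeriv k u w') : w =ᵐ[vol] w' := by
  have h0 : (w - w') =ᵐ[vol] 0 := by
    refine ae_eq_zero_of_test (h.right.sub h'.right) fun φ hφ => ?_
    have e := (h.integral_eq φ hφ).symm.trans (h'.integral_eq φ hφ)
    have e' := mul_left_cancel₀ (pow_ne_zero k (by norm_num : (-1 : ℝ) ≠ 0)) e
    simp only [Pi.sub_apply, sub_mul]
    rw [integral_sub (hφ.integrable_mul h.right) (hφ.integrable_mul h'.right), e', sub_self]
  filter_upwards [h0] with x hx
  simpa [sub_eq_zero] using hx

theorem IsWeakDeriv.congr {k : ℕ} {u u' w w' : ℝ → ℝ} (h : IsWeakDeriv k u w)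
    (hu : u =ᵐ[vol] u') (hw : w =ᵐ[vol] w') : IsWeakDeriv k u' w' where
  left := h.left.congr hu
  right := h.right.congr hw
  integral_eq φ hφ := by
    have e1 : ∫ x in Ioo (0 : ℝ) 1, u x * iteratedDeriv k φ x
        = ∫ x in Ioo (0 : ℝ) 1, u' x * iteratedDeriv k φ x :=
      integral_congr_ae (hu.mono fun x hx => by simp only [hx])
    have e2 : ∫ x in Ioo (0 : ℝ) 1, w x * φ x = ∫ x in Ioo (0 : ℝ) 1, w' x * φ x :=
      integral_congr_ae (hw.mono fun x hx => by simp only [hx])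
    rw [← e1, ← e2, h.integral_eq φ hφ]

theorem IsWeakDeriv.add {k : ℕ} {u u' w w' : ℝ → ℝ} (h : IsWeakDeriv k u w)
    (h' : IsWeakDeriv k u' w') : IsWeakDeriv k (u + u') (w + w') where
  left := h.left.add h'.left
  right := h.right.add h'.right
  integral_eq φ hφ := by
    simp only [Pi.add_apply, add_mul]
    rw [integral_add ((hφ.iteratedDeriv k).integrable_mul h.left)
      ((hφ.iteratedDeriv k).integrable_mul h'.left),
      integral_add (hφ.integrable_mul h.right) (hφ.integrable_mul h'.right),
      h.integral_eq φ hφ, h'.integral_eq φ hφ, mul_add]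

theorem IsWeakDeriv.smul {k : ℕ} {u w : ℝ → ℝ} (h : IsWeakDeriv k u w) (c : ℝ) :
    IsWeakDeriv k (c • u) (c • w) where
  left := h.left.smul c
  right := h.right.smul c
  integral_eq φ hφ := by
    simp only [Pi.smul_apply, smul_eq_mul, mul_assoc]
    rw [integral_const_mul, integral_const_mul, h.integral_eq φ hφ]
    ring

theorem IsWeakDeriv.zero (k : ℕ) : IsWeakDeriv k 0 0 where
  left := (integrable_zero ℝ ℝ _).integrableOn.locallyIntegrableOn
  right := (integrable_zero ℝ ℝ _).integrableOn.locallyIntegrableOn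
  integral_eq φ hφ := by simp

theorem HasZeroTrace.congr {f g : ℝ → ℝ} (h : HasZeroTrace f) (hfg : f =ᵐ[vol] g) :
    HasZeroTrace g := by
  obtain ⟨F, h1, h2, h3, h4⟩ := h
  exact ⟨F, h1, hfg.symm.trans h2, h3, h4⟩

theorem HasZeroTrace.zero : HasZeroTrace 0 :=
  ⟨0, continuousOn_const, EventuallyEq.rfl, rfl, rfl⟩

theorem HasZeroTrace.add {f g : ℝ → ℝ} (hf : HasZeroTrace f) (hg : HasZeroTrace g) :
    HasZeroTrace (f + g) := by
  obtain ⟨F, h1, h2, h3, h4⟩ := hf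
  obtain ⟨G, k1, k2, k3, k4⟩ := hg
  exact ⟨F + G, h1.add k1, h2.add k2, by simp [h3, k3], by simp [h4, k4]⟩

theorem HasZeroTrace.smul {f : ℝ → ℝ} (hf : HasZeroTrace f) (c : ℝ) :
    HasZeroTrace (c • f) := by
  obtain ⟨F, h1, h2, h3, h4⟩ := hf
  exact ⟨c • F, h1.const_smul c, h2.const_smul c, by simp [h3], by simp [h4]⟩

theorem MemH20.congr {u v : ℝ → ℝ} (h : MemH20 u) (huv : u =ᵐ[vol] v) : MemH20 v := by
  obtain ⟨h0, ht, ⟨u₁, h1, h2, h3⟩, u₂, h4, h5⟩ := h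
  exact ⟨h0.ae_eq huv, ht.congr huv, ⟨u₁, h1, h2.congr huv EventuallyEq.rfl, h3⟩,
    u₂, h4, h5.congr huv EventuallyEq.rfl⟩

theorem MemH20.zero : MemH20 0 :=
  ⟨MemLp.zero, HasZeroTrace.zero, ⟨0, MemLp.zero, IsWeakDeriv.zero 1, HasZeroTrace.zero⟩,
    0, MemLp.zero, IsWeakDeriv.zero 2⟩

theorem MemH20.add {u v : ℝ → ℝ} (h : MemH20 u) (k : MemH20 v) : MemH20 (u + v) := by
  obtain ⟨h0, ht, ⟨u₁, h1, h2, h3⟩, u₂, h4, h5⟩ := h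
  obtain ⟨k0, kt, ⟨v₁, k1, k2, k3⟩, v₂, k4, k5⟩ := k
  exact ⟨h0.add k0, ht.add kt, ⟨u₁ + v₁, h1.add k1, h2.add k2, h3.add k3⟩,
    u₂ + v₂, h4.add k4, h5.add k5⟩

theorem MemH20.smul {u : ℝ → ℝ} (h : MemH20 u) (c : ℝ) : MemH20 (c • u) := by
  obtain ⟨h0, ht, ⟨u₁, h1, h2, h3⟩, u₂, h4, h5⟩ := h
  exact ⟨h0.const_smul c, ht.smul c, ⟨c • u₁, h1.const_smul c, h2.smul c, h3.smul c⟩,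
    c • u₂, h4.const_smul c, h5.smul c⟩

/-- A test function of integral zero is the derivative of a test function. -/
theorem IsTest.exists_deriv_eq {g : ℝ → ℝ} (hg : IsTest g)
    (h0 : ∫ x in Ioo (0 : ℝ) 1, g x = 0) : ∃ Φ, IsTest Φ ∧ deriv Φ = g := by
  have hc : Continuous g := hg.contDiff.continuous
  have hd : ∀ x, HasDerivAt (fun x => ∫ t in (0 : ℝ)..x, g t) (g x) x := fun x =>
    intervalIntegral.integral_hasDerivAt_right (hc.intervalIntegrable _ _)
      hc.stronglyMeasurable.stronglyMeasurableAtFilter hc.continuousAt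
  have hder : deriv (fun x => ∫ t in (0 : ℝ)..x, g t) = g := funext fun x => (hd x).deriv
  obtain ⟨α, β, hα, hβ, hαβ⟩ : ∃ α β : ℝ, 0 < α ∧ β < 1 ∧ tsupport g ⊆ Icc α β := by
    rcases (tsupport g).eq_empty_or_nonempty with he | hne
    · exact ⟨1 / 2, 1 / 2, by norm_num, by norm_num, by simp [he]⟩
    · have hK : IsCompact (tsupport g) := hg.hasCompactSupport
      obtain ⟨m, hm, hm'⟩ := hK.exists_isLeast hne
      obtain ⟨M, hM, hM'⟩ := hK.exists_isGreatest hne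
      exact ⟨m, M, (hg.tsupport_subset hm).1, (hg.tsupport_subset hM).2,
        fun x hx => ⟨hm' hx, hM' hx⟩⟩
  have hz : ∀ x, x ∉ Icc α β → g x = 0 := fun x hx =>
    image_eq_zero_of_notMem_tsupport fun h => hx (hαβ h)
  have hsupp : Function.support (fun x => ∫ t in (0 : ℝ)..x, g t) ⊆ Icc α β := by
    intro x hx
    by_contra hn
    apply hx
    rw [mem_Icc, not_and_or, not_le, not_le] at hn
    rcases hn with hn | hn
    · change ∫ t in (0 : ℝ)..x, g t = 0
      rw [intervalIntegral.integral_congr (g := fun _ => (0 : ℝ))]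
      · simp
      · intro t ht
        apply hz
        rintro ⟨h1, -⟩
        have := ht.2
        have : t ≤ max 0 x := ht.2
        exact absurd (lt_of_lt_of_le (max_lt hα hn) h1) (not_lt.2 this)
    · change ∫ t in (0 : ℝ)..x, g t = 0
      have e1 : ∫ t in (0 : ℝ)..1, g t = 0 := by
        rw [intervalIntegral.integral_of_le zero_le_one, integral_Ioc_eq_integral_Ioo, h0]
      have e2 : ∫ t in (1 : ℝ)..x, g t = 0 := by
        rw [intervalIntegral.integral_congr (g := fun _ => (0 : ℝ))]
        · simp
        · intro t ht
          apply hz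
          rintro ⟨-, h1⟩
          have : min 1 x ≤ t := ht.1
          exact absurd (lt_of_le_of_lt h1 (lt_min hβ hn)) (not_lt.2 this)
      rw [← intervalIntegral.integral_add_adjacent_intervals (b := 1)
        (hc.intervalIntegrable _ _) (hc.intervalIntegrable _ _), e1, e2, add_zero]
  have hts : tsupport (fun x => ∫ t in (0 : ℝ)..x, g t) ⊆ Icc α β :=
    closure_minimal hsupp isClosed_Icc
  refine ⟨_, ⟨?_, ?_, ?_⟩, hder⟩
  · rw [contDiff_infty_iff_deriv, hder]
    exact ⟨fun x => (hd x).differentiableAt, hg.contDiff⟩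
  · exact HasCompactSupport.of_support_subset_isCompact isCompact_Icc hsupp
  · exact hts.trans fun x hx => ⟨hα.trans_le hx.1, hx.2.trans_lt hβ⟩

theorem exists_isTest_integral_eq_one :
    ∃ ψ, IsTest ψ ∧ ∫ x in Ioo (0 : ℝ) 1, ψ x = 1 := by
  let b : ContDiffBump (1 / 2 : ℝ) := ⟨1 / 8, 1 / 4, by norm_num, by norm_num⟩
  have hs : tsupport (b.normed volume) ⊆ Ioo 0 1 := by
    rw [b.tsupport_normed_eq, Real.closedBall_eq_Icc]
    intro x hx
    simp only [b, mem_Icc] at hx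
    exact ⟨by linarith [hx.1], by linarith [hx.2]⟩
  refine ⟨b.normed volume, ⟨b.contDiff_normed, b.hasCompactSupport_normed, hs⟩, ?_⟩
  rw [setIntegral_eq_integral_of_forall_compl_eq_zero, b.integral_normed]
  intro x hx
  exact image_eq_zero_of_notMem_tsupport fun h => hx (hs h)

/-- A function with vanishing weak derivative is a.e. constant. -/
theorem ae_eq_const_of_weakDeriv_zero {f : ℝ → ℝ} (hf : LocallyIntegrableOn f (Ioo 0 1))
    (h : ∀ φ, IsTest φ → ∫ x in Ioo (0 : ℝ) 1, f x * deriv φ x = 0) :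
    ∃ c : ℝ, f =ᵐ[vol] fun _ => c := by
  obtain ⟨ψ, hψ, hψ1⟩ := exists_isTest_integral_eq_one
  refine ⟨∫ x in Ioo (0 : ℝ) 1, f x * ψ x, ?_⟩
  set c := ∫ x in Ioo (0 : ℝ) 1, f x * ψ x with hcdef
  have hconst : LocallyIntegrableOn (fun _ : ℝ => c) (Ioo 0 1) :=
    (locallyIntegrable_const c).locallyIntegrableOn _
  have h1loc : LocallyIntegrableOn (fun _ : ℝ => (1 : ℝ)) (Ioo 0 1) :=
    (locallyIntegrable_const 1).locallyIntegrableOn _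
  have key : (f - fun _ => c) =ᵐ[vol] 0 := by
    refine ae_eq_zero_of_test (hf.sub hconst) fun φ hφ => ?_
    set m := ∫ x in Ioo (0 : ℝ) 1, φ x with hm
    have iφ : Integrable φ vol := by simpa using hφ.integrable_mul h1loc
    have iψ : Integrable ψ vol := by simpa using hψ.integrable_mul h1loc
    have hg : IsTest (φ + fun x => (-m) * ψ x) := hφ.add (hψ.const_mul (-m))
    obtain ⟨Φ, hΦ, hΦ'⟩ := hg.exists_deriv_eq (by
      simp only [Pi.add_apply]
      rw [integral_add iφ (iψ.const_mul _), integral_const_mul, hψ1]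
      simp [hm])
    have e := h Φ hΦ
    rw [hΦ'] at e
    have e' : ∫ x in Ioo (0 : ℝ) 1, (f x * φ x + (-m) * (f x * ψ x)) = 0 := by
      refine Eq.trans ?_ e
      exact integral_congr_ae (ae_of_all _ fun x => by simp only [Pi.add_apply]; ring)
    rw [integral_add (hφ.integrable_mul hf) ((hψ.integrable_mul hf).const_mul _),
      integral_const_mul] at e'
    simp only [Pi.sub_apply, sub_mul]
    rw [integral_sub (hφ.integrable_mul hf) (hφ.integrable_mul hconst), integral_const_mul,
      ← hm]
    linarith
  filter_upwards [key] with x hx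
  simpa [sub_eq_zero] using hx

theorem HasZeroTrace.ae_eq_zero_of_const {f : ℝ → ℝ} (hf : HasZeroTrace f) {c : ℝ}
    (hc : f =ᵐ[vol] fun _ => c) : f =ᵐ[vol] 0 := by
  obtain ⟨F, h1, h2, h3, -⟩ := hf
  have hFc : F =ᵐ[volume.restrict (Ioo 0 1)] fun _ => c := h2.symm.trans hc
  have hF : EqOn F (fun _ => c) (Ioo 0 1) :=
    Measure.eqOn_open_of_ae_eq hFc isOpen_Ioo (h1.mono Ioo_subset_Icc_self) continuousOn_const
  have hF' : EqOn F (fun _ => c) (Icc 0 1) :=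
    hF.of_subset_closure h1 continuousOn_const Ioo_subset_Icc_self
      (by rw [closure_Ioo zero_ne_one])
  have : c = 0 := by rw [← h3]; exact (hF' (left_mem_Icc.2 zero_le_one)).symm
  rw [this] at hc
  exact hc

theorem MemH20.ae_eq_zero {u u₂ : ℝ → ℝ} (h : MemH20 u) (h2 : IsWeakDeriv 2 u u₂)
    (h0 : u₂ =ᵐ[vol] 0) : u =ᵐ[vol] 0 := by
  obtain ⟨-, ht, ⟨u₁, -, k1, k2⟩, -⟩ := h
  have z1 : u₁ =ᵐ[vol] 0 := by
    obtain ⟨c, hc⟩ := ae_eq_const_of_weakDeriv_zero k1.right fun φ hφ => by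
      have hd : IsTest (deriv φ) := by simpa [iteratedDeriv_one] using hφ.iteratedDeriv 1
      have e1 := k1.integral_eq _ hd
      have e2 := (h2.congr EventuallyEq.rfl h0).integral_eq φ hφ
      have e3 : iteratedDeriv 2 φ = deriv (deriv φ) := by
        rw [iteratedDeriv_succ, iteratedDeriv_one]
      rw [iteratedDeriv_one, ← e3, e2] at e1
      simpa using e1.symm
    exact k2.ae_eq_zero_of_const hc
  obtain ⟨c, hc⟩ := ae_eq_const_of_weakDeriv_zero k1.left fun φ hφ => by
    have e := (k1.congr EventuallyEq.rfl z1).integral_eq φ hφ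
    simpa [iteratedDeriv_one] using e
  exact ht.ae_eq_zero_of_const hc

/-! ### The weighted spaces -/

/-- The measure `dx / a(x)` on `(0,1)`. -/
def weightedMeasure (a : ℝ → ℝ) : Measure ℝ :=
  vol.withDensity fun x => ENNReal.ofReal (1 / a x)

/-- `L²_{1/a}(0,1)` with `⟨u, v⟩ = ∫ u v / a`.  Since a degenerate coefficient is bounded and
positive on `(0,1)`, its elements are automatically (classes of) functions in `L²(0,1)`. -/
abbrev L2w (a : ℝ → ℝ) : Type := Lp ℝ 2 (weightedMeasure a)

theorem weightedMeasure_ac (a : ℝ → ℝ) : weightedMeasure a ≪ vol :=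
  withDensity_absolutelyContinuous _ _

theorem ac_weightedMeasure {a : ℝ → ℝ} (ha : IsDegenerateCoefficient a) :
    vol ≪ weightedMeasure a := by
  have hm : AEMeasurable a vol :=
    (ha.continuousOn.mono Ioo_subset_Icc_self).aemeasurable measurableSet_Ioo
  refine withDensity_absolutelyContinuous' (hm.const_div 1).ennreal_ofReal ?_
  refine (ae_restrict_iff' measurableSet_Ioo).2 (ae_of_all _ fun x hx => ?_)
  have := ha.pos x ⟨hx.1, hx.2.le⟩
  simp [this]

/-- `H²_{1/a}(0,1) = L²_{1/a}(0,1) ∩ H²₀(0,1)` as a subspace of `L²(0,1)`. -/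
def H2wSubmodule (a : ℝ → ℝ) : Submodule ℝ (Lp ℝ 2 vol) where
  carrier := {u | MemLp u 2 (weightedMeasure a) ∧ MemH20 u}
  zero_mem' := by
    have h0 := Lp.coeFn_zero ℝ 2 vol
    exact ⟨MemLp.zero.ae_eq ((weightedMeasure_ac a).ae_eq h0).symm, MemH20.zero.congr h0.symm⟩
  add_mem' {u v} hu hv := by
    have h0 := Lp.coeFn_add u v
    exact ⟨(hu.1.add hv.1).ae_eq ((weightedMeasure_ac a).ae_eq h0).symm,
      (hu.2.add hv.2).congr h0.symm⟩
  smul_mem' c u hu := by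
    have h0 := Lp.coeFn_smul c u
    exact ⟨(hu.1.const_smul c).ae_eq ((weightedMeasure_ac a).ae_eq h0).symm,
      (hu.2.smul c).congr h0.symm⟩

/-- `H²_{1/a}(0,1)` as a type of its own: it does not inherit the norm of `L²(0,1)`, but carries
the inner product `∫ u'' v''` defined below. -/
def H2w (a : ℝ → ℝ) : Type := H2wSubmodule a

instance (a : ℝ → ℝ) : AddCommGroup (H2w a) := inferInstanceAs (AddCommGroup (H2wSubmodule a))

instance (a : ℝ → ℝ) : Module ℝ (H2w a) := inferInstanceAs (Module ℝ (H2wSubmodule a))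

namespace H2w

variable {a : ℝ → ℝ}

/-- The inclusion `H²_{1/a}(0,1) → L²(0,1)`. -/
def toL2 : H2w a →ₗ[ℝ] Lp ℝ 2 vol := (H2wSubmodule a).subtype

theorem toL2_injective : Function.Injective (toL2 (a := a)) := Subtype.val_injective

theorem memLp (u : H2w a) : MemLp (toL2 u) 2 (weightedMeasure a) := u.2.1

theorem memH20 (u : H2w a) : MemH20 (toL2 u) := u.2.2

/-- The inclusion `H²_{1/a}(0,1) → L²_{1/a}(0,1)`. -/
def toL2w : H2w a →ₗ[ℝ] L2w a where
  toFun u := (memLp u).toLp _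
  map_add' u v := by
    rw [← MemLp.toLp_add, MemLp.toLp_eq_toLp_iff, map_add]
    exact (weightedMeasure_ac a).ae_eq (Lp.coeFn_add _ _)
  map_smul' c u := by
    rw [RingHom.id_apply, ← MemLp.toLp_const_smul, MemLp.toLp_eq_toLp_iff, map_smul]
    exact (weightedMeasure_ac a).ae_eq (Lp.coeFn_smul _ _)

theorem coeFn_toL2w (u : H2w a) : toL2w u =ᵐ[weightedMeasure a] toL2 u :=
  (memLp u).coeFn_toLp

theorem toL2w_injective (ha : IsDegenerateCoefficient a) :
    Function.Injective (toL2w (a := a)) := by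
  intro u v huv
  apply toL2_injective
  refine Lp.ext ((ac_weightedMeasure ha).ae_eq ?_)
  exact (MemLp.toLp_eq_toLp_iff (memLp u) (memLp v)).1 huv

theorem exists_deriv2 (u : H2w a) : ∃ w : Lp ℝ 2 vol, IsWeakDeriv 2 (toL2 u) w := by
  obtain ⟨-, -, -, w, hw, h⟩ := memH20 u
  exact ⟨hw.toLp w, h.congr EventuallyEq.rfl hw.coeFn_toLp.symm⟩

/-- The weak second derivative `u ↦ u''` as a linear map into `L²(0,1)`. -/
def deriv2 : H2w a →ₗ[ℝ] Lp ℝ 2 vol where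
  toFun u := (exists_deriv2 u).choose
  map_add' u v := by
    refine Lp.ext ((exists_deriv2 (u + v)).choose_spec.unique ?_)
    refine ((exists_deriv2 u).choose_spec.add (exists_deriv2 v).choose_spec).congr ?_
      (Lp.coeFn_add _ _).symm
    rw [map_add]
    exact (Lp.coeFn_add _ _).symm
  map_smul' c u := by
    refine Lp.ext ((exists_deriv2 (c • u)).choose_spec.unique ?_)
    refine ((exists_deriv2 u).choose_spec.smul c).congr ?_ (Lp.coeFn_smul _ _).symm
    rw [map_smul]
    exact (Lp.coeFn_smul _ _).symm

theorem isWeakDeriv_deriv2 (u : H2w a) : IsWeakDeriv 2 (toL2 u) (deriv2 u) :=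
  (exists_deriv2 u).choose_spec

theorem eq_zero_of_deriv2_eq_zero (u : H2w a) (h : deriv2 u = 0) : u = 0 := by
  apply toL2_injective
  rw [map_zero, Lp.eq_zero_iff_ae_eq_zero]
  refine (memH20 u).ae_eq_zero (isWeakDeriv_deriv2 u) ?_
  rw [h]
  exact Lp.coeFn_zero ℝ 2 vol

theorem integral_deriv2_mul (u v : H2w a) :
    ∫ x in Ioo (0 : ℝ) 1, deriv2 u x * deriv2 v x = inner ℝ (deriv2 u) (deriv2 v) := by
  rw [L2.inner_def]
  exact integral_congr_ae (ae_of_all _ fun x => by simp [mul_comm])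

/-- The inner product `⟨u, v⟩ = ∫₀¹ u'' v'' dx` on `H²_{1/a}(0,1)`. -/
@[reducible] def innerCore (a : ℝ → ℝ) : InnerProductSpace.Core ℝ (H2w a) where
  inner u v := ∫ x in Ioo (0 : ℝ) 1, deriv2 u x * deriv2 v x
  conj_inner_symm u v := by simp [mul_comm]
  re_inner_nonneg u := by
    rw [integral_deriv2_mul]
    exact inner_self_nonneg
  add_left u v w := by
    rw [integral_deriv2_mul, integral_deriv2_mul, integral_deriv2_mul, map_add, inner_add_left]
  smul_left u v c := by
    rw [integral_deriv2_mul, integral_deriv2_mul, map_smul, inner_smul_left]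
  definite u h := by
    rw [integral_deriv2_mul, inner_self_eq_zero] at h
    exact eq_zero_of_deriv2_eq_zero u h

instance : NormedAddCommGroup (H2w a) := (innerCore a).toNormedAddCommGroup

instance : InnerProductSpace ℝ (H2w a) := InnerProductSpace.ofCore (innerCore a).toCore

end H2w

/-- The energy space `𝓗₀ = H²_{1/a}(0,1) × L²_{1/a}(0,1)` with the inner product
`⟨(u,v), (ũ,ṽ)⟩ = ∫ u'' ũ'' + ∫ v ṽ / a`. -/
abbrev H0 (a : ℝ → ℝ) : Type := WithLp 2 (H2w a × L2w a)

/-! ### The operators -/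

/-- `w = u''''` is the fourth weak derivative of `u`, and `a u'''' ∈ L²_{1/a}(0,1)`. -/
def IsAdmissibleDeriv4 (a : ℝ → ℝ) (u : H2w a) (w : ℝ → ℝ) : Prop :=
  IsWeakDeriv 4 (H2w.toL2 u) w ∧ MemLp (fun x => a x * w x) 2 (weightedMeasure a)

theorem IsAdmissibleDeriv4.add {a : ℝ → ℝ} {u v : H2w a} {w w' : ℝ → ℝ}
    (h : IsAdmissibleDeriv4 a u w) (h' : IsAdmissibleDeriv4 a v w') :
    IsAdmissibleDeriv4 a (u + v) (w + w') := by
  refine ⟨(h.1.add h'.1).congr ?_ EventuallyEq.rfl, ?_⟩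
  · rw [map_add]
    exact (Lp.coeFn_add _ _).symm
  · exact (h.2.add h'.2).ae_eq (ae_of_all _ fun x => by simp [mul_add])

theorem IsAdmissibleDeriv4.smul {a : ℝ → ℝ} {u : H2w a} {w : ℝ → ℝ}
    (h : IsAdmissibleDeriv4 a u w) (c : ℝ) : IsAdmissibleDeriv4 a (c • u) (c • w) := by
  refine ⟨(h.1.smul c).congr ?_ EventuallyEq.rfl, ?_⟩
  · rw [map_smul]
    exact (Lp.coeFn_smul _ _).symm
  · exact (h.2.const_smul c).ae_eq (ae_of_all _ fun x => by simp; ring)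

theorem IsAdmissibleDeriv4.zero (a : ℝ → ℝ) : IsAdmissibleDeriv4 a 0 0 := by
  refine ⟨(IsWeakDeriv.zero 4).congr ?_ EventuallyEq.rfl, ?_⟩
  · rw [map_zero]
    exact (Lp.coeFn_zero ℝ 2 vol).symm
  · exact MemLp.zero.ae_eq (ae_of_all _ fun x => by simp)

theorem IsAdmissibleDeriv4.toLp_eq {a : ℝ → ℝ} {u : H2w a} {w w' : ℝ → ℝ}
    (h : IsAdmissibleDeriv4 a u w) (h' : IsAdmissibleDeriv4 a u w') :
    h.2.toLp _ = h'.2.toLp _ := by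
  rw [MemLp.toLp_eq_toLp_iff]
  refine (weightedMeasure_ac a).ae_eq ?_
  filter_upwards [h.1.unique h'.1] with x hx
  rw [hx]

/-- The operator `A u = a u''''` with domain
`D(A) = {u ∈ H²_{1/a}(0,1) : a u'''' ∈ L²_{1/a}(0,1)}` and values in `L²_{1/a}(0,1)`. -/
def opA (a : ℝ → ℝ) : H2w a →ₗ.[ℝ] L2w a where
  domain :=
    { carrier := {u | ∃ w, IsAdmissibleDeriv4 a u w}
      zero_mem' := ⟨0, IsAdmissibleDeriv4.zero a⟩
      add_mem' := fun ⟨w, hw⟩ ⟨w', hw'⟩ => ⟨w + w', hw.add hw'⟩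
      smul_mem' := fun c _ ⟨w, hw⟩ => ⟨c • w, hw.smul c⟩ }
  toFun :=
    { toFun := fun u => u.2.choose_spec.2.toLp (fun x => a x * u.2.choose x)
      map_add' := fun u v => by
        rw [IsAdmissibleDeriv4.toLp_eq (u + v).2.choose_spec
          (u.2.choose_spec.add v.2.choose_spec), ← MemLp.toLp_add, MemLp.toLp_eq_toLp_iff]
        exact ae_of_all _ fun x => by simp [mul_add]
      map_smul' := fun c u => by
        rw [IsAdmissibleDeriv4.toLp_eq (c • u).2.choose_spec (u.2.choose_spec.smul c),
          RingHom.id_apply, ← MemLp.toLp_const_smul, MemLp.toLp_eq_toLp_iff]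
        exact ae_of_all _ fun x => by simp; ring }

/-- `A u` is the class of `a u''''`, for any version of the weak derivative `u''''`. -/
theorem opA_apply {a : ℝ → ℝ} (u : (opA a).domain) {w : ℝ → ℝ}
    (h : IsAdmissibleDeriv4 a u w) : opA a u = h.2.toLp _ :=
  IsAdmissibleDeriv4.toLp_eq u.2.choose_spec h

/-- `D(𝒜) = D(A) × H²_{1/a}(0,1)`, as a subspace of `𝓗₀`. -/
def opMatrixDomain (a : ℝ → ℝ) : Submodule ℝ (H0 a) :=
  ((opA a).domain.comap (WithLp.fstₗ 2 ℝ (H2w a) (L2w a))) ⊓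
    ((LinearMap.range (H2w.toL2w (a := a))).comap (WithLp.sndₗ 2 ℝ (H2w a) (L2w a)))

/-- The second component of an element of `D(𝒜)`, as an element of `H²_{1/a}(0,1)`. -/
def domainSnd {a : ℝ → ℝ} (ha : IsDegenerateCoefficient a) :
    opMatrixDomain a →ₗ[ℝ] H2w a :=
  (LinearEquiv.ofInjective H2w.toL2w (H2w.toL2w_injective ha)).symm.toLinearMap ∘ₗ
    ((WithLp.sndₗ 2 ℝ (H2w a) (L2w a)).restrict fun _ hU => hU.2)

theorem toL2w_domainSnd {a : ℝ → ℝ} (ha : IsDegenerateCoefficient a) (U : opMatrixDomain a) :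
    H2w.toL2w (domainSnd ha U) = (U : H0 a).snd :=
  congrArg Subtype.val
    ((LinearEquiv.ofInjective H2w.toL2w (H2w.toL2w_injective ha)).apply_symm_apply _)

/-- The matrix operator `𝒜 (u, v) = (v, -A u)` in `𝓗₀` with domain `D(A) × H²_{1/a}(0,1)`. -/
def opMatrix {a : ℝ → ℝ} (ha : IsDegenerateCoefficient a) : H0 a →ₗ.[ℝ] H0 a where
  domain := opMatrixDomain a
  toFun :=
    (WithLp.linearEquiv 2 ℝ (H2w a × L2w a)).symm.toLinearMap ∘ₗ
      (domainSnd ha).prod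
        (-((opA a).toFun ∘ₗ ((WithLp.fstₗ 2 ℝ (H2w a) (L2w a)).restrict
          (p := opMatrixDomain a) (q := (opA a).domain) fun _ hU => hU.1)))

theorem opMatrix_apply {a : ℝ → ℝ} (ha : IsDegenerateCoefficient a) {u : H2w a}
    (hu : u ∈ (opA a).domain) (v : H2w a) :
    ∃ h : WithLp.toLp 2 (u, H2w.toL2w v) ∈ (opMatrix ha).domain,
      opMatrix ha ⟨WithLp.toLp 2 (u, H2w.toL2w v), h⟩ = WithLp.toLp 2 (v, -opA a ⟨u, hu⟩) := by
  have h : WithLp.toLp 2 (u, H2w.toL2w v) ∈ opMatrixDomain a := ⟨hu, v, rfl⟩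
  have hv : domainSnd ha ⟨_, h⟩ = v := H2w.toL2w_injective ha (toL2w_domainSnd ha ⟨_, h⟩)
  refine ⟨h, ?_⟩
  change WithLp.toLp 2 (domainSnd ha ⟨_, h⟩, -opA a ⟨u, hu⟩) = _
  rw [hv]

/-! ### Semigroups -/

section Semigroup

variable {X : Type*} [NormedAddCommGroup X] [InnerProductSpace ℝ X]

/-- Dissipativity of an unbounded operator: `‖λ x - B x‖ ≥ λ ‖x‖` for `λ > 0`, `x ∈ D(B)`. -/
def IsDissipative (B : X →ₗ.[ℝ] X) : Prop :=
  ∀ l : ℝ, 0 < l → ∀ x : B.domain, l * ‖(x : X)‖ ≤ ‖l • (x : X) - B x‖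

/-- Non-positivity of an unbounded operator: `⟨B x, x⟩ ≤ 0` for `x ∈ D(B)`. -/
def IsNonpositive (B : X →ₗ.[ℝ] X) : Prop :=
  ∀ x : B.domain, inner ℝ (B x) (x : X) ≤ 0

/-- `S` is a strongly continuous semigroup of contractions on `X`. -/
structure IsContractionSemigroup (S : ℝ≥0 → X →L[ℝ] X) : Prop where
  map_zero : S 0 = ContinuousLinearMap.id ℝ X
  map_add : ∀ s t, S (s + t) = (S s).comp (S t)
  continuous_orbit : ∀ x, Continuous fun t => S t x
  norm_le_one : ∀ t, ‖S t‖ ≤ 1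

/-- `B` is the infinitesimal generator of `S`: `x ∈ D(B)` and `B x = y` if and only if
`(S h x - x) / h → y` as `h → 0⁺`. -/
def IsGenerator (B : X →ₗ.[ℝ] X) (S : ℝ≥0 → X →L[ℝ] X) : Prop :=
  ∀ x y : X, (x, y) ∈ B.graph ↔
    Tendsto (fun h : ℝ≥0 => (h : ℝ)⁻¹ • (S h x - x)) (𝓝[>] 0) (𝓝 y)

end Semigroup

end DegenerateBeam

end

/-!
The matrix operator `𝒜` is governed by one bounded map, the inclusion
`J : H²_{1/a}(0,1) → L²_{1/a}(0,1)`.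

* Functions of `H²₀(0,1)` are second primitives of `u''`, so `u(x)² ≤ x³ ∫ (u'')²`
  (`MemH20.ae_eq_primitive`, `sq_primitive_primitive_le`). The growth condition on `a` makes `x³ / a`
  bounded (`IsDegenerateCoefficient.exists_bound`), hence `J` is defined on all of `H²₀(0,1)` and
  bounded. The map `u ↦ u''` is an isometry of `H²_{1/a}(0,1)` onto the orthogonal complement of the
  affine functions in `L²(0,1)`, so `H²_{1/a}(0,1)` is complete (`H2w.completeSpace`).
* Test functions are dense in `H²_{1/a}(0,1)`: if `u''` is orthogonal to all `φ''` it is affine, and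
  it is orthogonal to affine functions (`H2w.eq_zero_of_inner_test`). Therefore `u ∈ D(A)` and
  `A u = k` hold if and only if `∫ u'' v'' = ∫ k v / a` for all `v`, that is, `u = J* k`
  (`mem_graph_opA_iff`). This contains the Gauss–Green formula.

With `u = J* k`, the operator is `𝒜 (u, J v) = (v, -k)`. It follows that `⟨𝒜 U, U⟩ = 0`, which gives
non-positivity and dissipativity. The domain is dense because `J` and `J*` have dense ranges.
The equation `l U - 𝒜 U = (f, g)` reduces to `u + l² J* J u = J* (g + l J f)`, which the Lax–Milgram
theorem solves (`exists_smul_sub_opMatrix_eq`).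

The semigroup is obtained from the Hille–Yosida theorem, proved here for a densely defined
non-positive operator `B` on a real Hilbert space with `l - B` onto for all `l > 0`
(`IsNonpositive.exists_contractionSemigroup`). The Yosida approximations `n² (n - B)⁻¹ - n` are
bounded, commute, are non-positive and converge to `B` on its domain; their exponentials are
contractions, converge pointwise, and the limit has generator `B`.
-/

namespace DegenerateBeam

section HilleYosida

variable {X : Type*} [NormedAddCommGroup X] [InnerProductSpace ℝ X]

/-! ### Resolvents of dissipative operators -/

theorem IsNonpositive.isDissipative {B : X →ₗ.[ℝ] X} (hB : IsNonpositive B) :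
    IsDissipative B := by
  intro l hl x
  rcases (norm_nonneg (x : X)).eq_or_lt with h0 | h0
  · rw [← h0, mul_zero]
    exact norm_nonneg _
  · refine le_of_mul_le_mul_right ?_ h0
    refine le_trans ?_ (real_inner_le_norm _ _)
    rw [inner_sub_left, real_inner_smul_left, real_inner_self_eq_norm_sq]
    linarith [hB x, sq ‖(x : X)‖, mul_assoc l ‖(x : X)‖ ‖(x : X)‖, congrArg (l * ·) (sq ‖(x : X)‖)]

/-- The resolvent `(l - B)⁻¹` of a dissipative operator. -/
theorem IsDissipative.exists_resolvent {B : X →ₗ.[ℝ] X} (hB : IsDissipative B) {l : ℝ}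
    (hl : 0 < l) (hsurj : ∀ y, ∃ x : B.domain, l • (x : X) - B x = y) :
    ∃ R : X →L[ℝ] X, (∀ y, l * ‖R y‖ ≤ ‖y‖) ∧
      (∀ y, ∃ h : R y ∈ B.domain, l • R y - B ⟨R y, h⟩ = y) ∧
      ∀ x : B.domain, R (l • (x : X) - B x) = x := by
  choose r hr using hsurj
  have hinj : ∀ x x' : B.domain, l • (x : X) - B x = l • (x' : X) - B x' → x = x' := by
    intro x x' h
    have h1 := hB l hl (x - x')
    have e : l • ((x - x' : B.domain) : X) - B (x - x')
        = (l • (x : X) - B x) - (l • (x' : X) - B x') := by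
      rw [B.map_sub, Submodule.coe_sub, smul_sub]
      abel
    rw [e, h, sub_self, norm_zero] at h1
    have h2 : ‖((x - x' : B.domain) : X)‖ = 0 :=
      le_antisymm (by nlinarith [norm_nonneg ((x - x' : B.domain) : X)]) (norm_nonneg _)
    have h3 : x - x' = 0 := Subtype.ext (norm_eq_zero.1 h2)
    exact sub_eq_zero.1 h3
  let R : X →ₗ[ℝ] X :=
    { toFun := fun y => r y
      map_add' := fun y y' => by
        rw [← Submodule.coe_add]
        refine congrArg Subtype.val (hinj _ _ ?_)
        rw [hr, B.map_add, Submodule.coe_add, smul_add, add_sub_add_comm, hr, hr]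
      map_smul' := fun c y => by
        rw [RingHom.id_apply, ← Submodule.coe_smul]
        refine congrArg Subtype.val (hinj _ _ ?_)
        rw [hr, B.map_smul, Submodule.coe_smul, smul_comm l c, ← smul_sub, hr] }
  have hb : ∀ y, l * ‖R y‖ ≤ ‖y‖ := fun y => by
    have h := hB l hl (r y)
    rwa [hr] at h
  refine ⟨R.mkContinuous l⁻¹ fun y => ?_, hb, fun y => ⟨(r y).2, hr y⟩, fun x => ?_⟩
  · rw [inv_mul_eq_div, le_div_iff₀ hl, mul_comm]
    exact hb y
  · exact congrArg Subtype.val (hinj _ _ (hr _))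

/-- If `I - B` is onto and the generator `G` of a contraction semigroup extends `B`, then `G = B`,
because `I - G` is injective. -/
theorem IsContractionSemigroup.isGenerator {S : ℝ≥0 → X →L[ℝ] X} (hS : IsContractionSemigroup S)
    {B : X →ₗ.[ℝ] X} (hsurj : ∀ y, ∃ x : B.domain, (x : X) - B x = y)
    (hext : ∀ z : B.domain,
      Tendsto (fun h : ℝ≥0 => (h : ℝ)⁻¹ • (S h z - z)) (𝓝[>] 0) (𝓝 (B z))) :
    IsGenerator B S := by
  intro x y
  constructor
  · intro h
    obtain ⟨z, hz, hzy⟩ := (LinearPMap.mem_graph_iff B).1 h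
    simp only at hz hzy
    rw [← hz, ← hzy]
    exact hext z
  · intro h
    obtain ⟨z, hz⟩ := hsurj (x - y)
    -- The difference `w = x - z` satisfies `w = lim (S h w - w) / h`, which forces `w = 0`.
    have hw : Tendsto (fun h : ℝ≥0 => (h : ℝ)⁻¹ • (S h (x - z) - (x - z))) (𝓝[>] 0)
        (𝓝 (x - z)) := by
      have e : x - (z : X) = y - B z := by
        rw [sub_eq_sub_iff_add_eq_add] at hz ⊢
        rw [add_comm y, ← hz, add_comm]
      nth_rewrite 3 [e]
      refine (h.sub (hext z)).congr fun h => ?_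
      rw [← smul_sub, map_sub]
      congr 1
      abel
    have hinner := hw.inner (tendsto_const_nhds (x := x - (z : X))) (𝕜 := ℝ)
    have hle : inner ℝ (x - (z : X)) (x - z) ≤ 0 := by
      refine le_of_tendsto hinner (Eventually.of_forall fun h => ?_)
      rw [real_inner_smul_left, inner_sub_left, real_inner_self_eq_norm_sq]
      have h1 := real_inner_le_norm (S h (x - z)) (x - z)
      have h2 := (S h).le_of_opNorm_le (hS.norm_le_one h) (x - z)
      have h3 := mul_le_mul_of_nonneg_right h2 (norm_nonneg (x - (z : X)))
      exact mul_nonpos_of_nonneg_of_nonpos (by positivity) (by nlinarith)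
    have hxz : x - (z : X) = 0 := inner_self_eq_zero.1 (le_antisymm hle real_inner_self_nonneg)
    rw [sub_eq_zero] at hxz
    refine (LinearPMap.mem_graph_iff B).2 ⟨z, hxz.symm, ?_⟩
    rw [hxz] at hz
    simpa using hz

/-! ### Exponentials of bounded non-positive operators -/

variable [CompleteSpace X]


theorem hasDerivAt_exp_smul_apply (P : X →L[ℝ] X) (x : X) (t : ℝ) :
    HasDerivAt (fun s : ℝ => NormedSpace.exp (s • P) x) (NormedSpace.exp (t • P) (P x)) t := by
  simpa using (hasDerivAt_exp_smul_const P t).clm_apply (hasDerivAt_const t x)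

theorem hasDerivAt_exp_smul_apply' (P : X →L[ℝ] X) (x : X) (t : ℝ) :
    HasDerivAt (fun s : ℝ => NormedSpace.exp (s • P) x) (P (NormedSpace.exp (t • P) x)) t := by
  simpa using (hasDerivAt_exp_smul_const' P t).clm_apply (hasDerivAt_const t x)

/-- The energy `‖e^{tP} x‖²` decreases, since its derivative is `2 ⟨P e^{tP} x, e^{tP} x⟩`. -/
theorem norm_exp_smul_apply_le {P : X →L[ℝ] X} (hP : ∀ x, inner ℝ (P x) x ≤ 0) {t : ℝ}
    (ht : 0 ≤ t) (x : X) : ‖NormedSpace.exp (t • P) x‖ ≤ ‖x‖ := by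
  have hd := fun s : ℝ => (hasDerivAt_exp_smul_apply' P x s).norm_sq
  have hanti : Antitone fun s : ℝ => ‖NormedSpace.exp (s • P) x‖ ^ 2 := by
    refine antitone_of_deriv_nonpos (fun s => (hd s).differentiableAt) fun s => ?_
    rw [(hd s).deriv, real_inner_comm]
    linarith [hP (NormedSpace.exp (s • P) x)]
  have h := hanti ht
  simp only [zero_smul, NormedSpace.exp_zero, one_apply_eq_self] at h
  exact (sq_le_sq₀ (norm_nonneg _) (norm_nonneg _)).1 h

theorem norm_exp_smul_sub_sub_le (P : X →L[ℝ] X) (x y : X) {t C : ℝ} (ht : 0 ≤ t)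
    (hC : ∀ s ∈ Icc 0 t, ‖NormedSpace.exp (s • P) (P x) - y‖ ≤ C) :
    ‖NormedSpace.exp (t • P) x - x - t • y‖ ≤ C * t := by
  have hd : ∀ s ∈ Icc 0 t, HasDerivWithinAt
      (fun s : ℝ => NormedSpace.exp (s • P) x - s • y)
      (NormedSpace.exp (s • P) (P x) - y) (Icc 0 t) s := fun s _ => by
    simpa using ((hasDerivAt_exp_smul_apply P x s).fun_sub
      ((hasDerivAt_id' s).smul_const y)).hasDerivWithinAt
  have h := norm_image_sub_le_of_norm_deriv_le_segment' hd
    (fun s hs => hC s (Ico_subset_Icc_self hs)) t (right_mem_Icc.2 ht)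
  simp only [zero_smul, NormedSpace.exp_zero, one_apply_eq_self, sub_zero] at h
  rwa [sub_right_comm]

theorem norm_exp_smul_sub_le {P : X →L[ℝ] X} (hP : ∀ x, inner ℝ (P x) x ≤ 0) (x : X) {t : ℝ}
    (ht : 0 ≤ t) : ‖NormedSpace.exp (t • P) x - x‖ ≤ t * ‖P x‖ := by
  have h := norm_exp_smul_sub_sub_le P x 0 (C := ‖P x‖) ht fun s hs => by
    rw [sub_zero]
    exact norm_exp_smul_apply_le hP hs.1 _
  rwa [smul_zero, sub_zero, mul_comm] at h

/-- Differentiating `s ↦ e^{sP} e^{(t-s)Q} x` compares the semigroups of commuting `P` and `Q`. -/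
theorem norm_exp_smul_sub_exp_smul_le {P Q : X →L[ℝ] X} (hP : ∀ x, inner ℝ (P x) x ≤ 0)
    (hQ : ∀ x, inner ℝ (Q x) x ≤ 0) (hPQ : Commute P Q) (x : X) {t : ℝ} (ht : 0 ≤ t) :
    ‖NormedSpace.exp (t • P) x - NormedSpace.exp (t • Q) x‖ ≤ t * ‖P x - Q x‖ := by
  have hd : ∀ s ∈ Icc 0 t, HasDerivWithinAt
      (fun s : ℝ => NormedSpace.exp (s • P) (NormedSpace.exp ((t - s) • Q) x))
      (NormedSpace.exp (s • P) (NormedSpace.exp ((t - s) • Q) (P x - Q x))) (Icc 0 t) s := by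
    intro s _
    have h1 := hasDerivAt_exp_smul_const P s
    have h2 : HasDerivAt (fun s : ℝ => NormedSpace.exp ((t - s) • Q) x)
        (-(NormedSpace.exp ((t - s) • Q) (Q x))) s := by
      simpa [Function.comp_def] using (hasDerivAt_exp_smul_apply Q x (t - s)).scomp s
        ((hasDerivAt_id s).const_sub t)
    have hc : P (NormedSpace.exp ((t - s) • Q) x) = NormedSpace.exp ((t - s) • Q) (P x) :=
      congrArg (fun T : X →L[ℝ] X => T x) (hPQ.smul_right (t - s)).exp_right.eq
    have h3 := (h1.clm_apply h2).hasDerivWithinAt (s := Icc 0 t)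
    convert h3 using 1
    rw [mul_apply_eq_comp, hc]
    simp only [map_neg, sub_eq_add_neg, map_add]
  have h := norm_image_sub_le_of_norm_deriv_le_segment' hd (C := ‖P x - Q x‖)
    (fun s hs => (norm_exp_smul_apply_le hP hs.1 _).trans
      (norm_exp_smul_apply_le hQ (sub_nonneg.2 hs.2.le) _)) t (right_mem_Icc.2 ht)
  simpa [mul_comm] using h

/-! ### Generation of contraction semigroups -/

/-- If commuting bounded non-positive operators converge pointwise on a dense set to some `B`,
their exponentials converge pointwise. -/
theorem exists_tendsto_exp_smul {P : ℕ → X →L[ℝ] X} (hP : ∀ n x, inner ℝ (P n x) x ≤ 0)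
    (hc : ∀ m n, Commute (P m) (P n)) {B : X →ₗ.[ℝ] X} (hB : Dense (B.domain : Set X))
    (hPB : ∀ z : B.domain, Tendsto (fun n => P n z) atTop (𝓝 (B z))) (t : ℝ≥0) (x : X) :
    ∃ y, Tendsto (fun n => NormedSpace.exp ((t : ℝ) • P n) x) atTop (𝓝 y) := by
  apply cauchySeq_tendsto_of_complete
  rw [Metric.cauchySeq_iff]
  intro ε hε
  obtain ⟨z, hz, hxz⟩ := hB.exists_dist_lt x (show 0 < ε / 3 by positivity)
  obtain ⟨N, hN⟩ := Metric.cauchySeq_iff.1 (hPB ⟨z, hz⟩).cauchySeq (ε / (3 * (t + 1)))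
    (by positivity)
  refine ⟨N, fun m hm n hn => ?_⟩
  have h1 := norm_exp_smul_apply_le (hP m) t.coe_nonneg (x - z)
  have h2 := norm_exp_smul_apply_le (hP n) t.coe_nonneg (z - x)
  have h3 := norm_exp_smul_sub_exp_smul_le (hP m) (hP n) (hc m n) z t.coe_nonneg
  have h4 := hN m hm n hn
  rw [dist_eq_norm] at h4 hxz ⊢
  have h5 : (t : ℝ) * ‖P m z - P n z‖ ≤ ε / 3 := by
    calc (t : ℝ) * ‖P m z - P n z‖ ≤ (t + 1) * (ε / (3 * (t + 1))) := by
          gcongr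
          linarith
      _ = ε / 3 := by field_simp
  have e : NormedSpace.exp ((t : ℝ) • P m) x - NormedSpace.exp ((t : ℝ) • P n) x
      = NormedSpace.exp ((t : ℝ) • P m) (x - z) + (NormedSpace.exp ((t : ℝ) • P m) z
        - NormedSpace.exp ((t : ℝ) • P n) z) + NormedSpace.exp ((t : ℝ) • P n) (z - x) := by
    simp only [map_sub]
    abel
  rw [e]
  rw [norm_sub_rev] at h2
  exact (norm_add₃_le).trans_lt (by linarith [h1, h2, h3, h5])

/-- The pointwise limit of the exponentials `e^{t Pₙ}` is a contraction semigroup whose generator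
extends `lim Pₙ`. -/
theorem exists_contractionSemigroup_of_tendsto {P : ℕ → X →L[ℝ] X}
    (hP : ∀ n x, inner ℝ (P n x) x ≤ 0) (hc : ∀ m n, Commute (P m) (P n)) {B : X →ₗ.[ℝ] X}
    (hB : Dense (B.domain : Set X))
    (hPB : ∀ z : B.domain, Tendsto (fun n => P n z) atTop (𝓝 (B z))) :
    ∃ S : ℝ≥0 → X →L[ℝ] X, IsContractionSemigroup S ∧ ∀ z : B.domain,
      Tendsto (fun h : ℝ≥0 => (h : ℝ)⁻¹ • (S h z - z)) (𝓝[>] 0) (𝓝 (B z)) := by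
  -- `S t` is bounded as a pointwise limit of bounded operators (Banach–Steinhaus)
  choose S₀ hS₀ using exists_tendsto_exp_smul hP hc hB hPB
  let S : ℝ≥0 → X →L[ℝ] X := fun t =>
    continuousLinearMapOfTendsto (l := atTop) (fun n => NormedSpace.exp ((t : ℝ) • P n))
      (tendsto_pi_nhds.2 (hS₀ t))
  have hS : ∀ (t : ℝ≥0) (x : X),
      Tendsto (fun n => NormedSpace.exp ((t : ℝ) • P n) x) atTop (𝓝 (S t x)) := hS₀
  have hle : ∀ (t : ℝ≥0) (x : X), ‖S t x‖ ≤ ‖x‖ := fun t x =>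
    le_of_tendsto (hS t x).norm
      (Eventually.of_forall fun n => norm_exp_smul_apply_le (hP n) t.coe_nonneg x)
  have hadd : ∀ s t x, S (s + t) x = S s (S t x) := by
    intro s t x
    refine tendsto_nhds_unique (hS (s + t) x) ?_
    have h1 : Tendsto (fun n => NormedSpace.exp ((s : ℝ) • P n)
        (NormedSpace.exp ((t : ℝ) • P n) x - S t x)) atTop (𝓝 0) := by
      refine squeeze_zero_norm (fun n => norm_exp_smul_apply_le (hP n) s.coe_nonneg _) ?_
      simpa using ((hS t x).sub_const (S t x)).norm
    have h2 := h1.add (hS s (S t x))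
    rw [zero_add] at h2
    refine h2.congr fun n => ?_
    have hcm : Commute ((s : ℝ) • P n) ((t : ℝ) • P n) :=
      ((Commute.refl (P n)).smul_left _).smul_right _
    let _ : NormedAlgebra ℚ (X →L[ℝ] X) := NormedAlgebra.restrictScalars ℚ ℝ _
    rw [NNReal.coe_add, add_smul, NormedSpace.exp_add_of_commute hcm]
    simp
  have hgrowth : ∀ (t : ℝ≥0) (z : B.domain), ‖S t z - z‖ ≤ (t : ℝ) * ‖B z‖ := fun t z =>
    le_of_tendsto_of_tendsto ((hS t z).sub_const _).norm ((hPB z).norm.const_mul _)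
      (Eventually.of_forall fun n => norm_exp_smul_sub_le (hP n) _ t.coe_nonneg)
  have hosc : ∀ (t : ℝ≥0) (x : X) (z : B.domain), ‖S t x - x‖ ≤ 2 * ‖x - z‖ + t * ‖B z‖ := by
    intro t x z
    have e : S t x - x = S t (x - z) + (S t z - z) - (x - z) := by
      rw [map_sub]
      abel
    rw [e]
    have h1 := norm_sub_le (S t (x - z) + (S t z - z)) (x - z)
    have h2 := norm_add_le (S t (x - z)) (S t z - z)
    linarith [hle t (x - z), hgrowth t z]
  have hcont : ∀ x, Continuous fun t => S t x := by
    intro x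
    have key : ∀ (s t : ℝ≥0) (z : B.domain),
        dist (S s x) (S t x) ≤ 2 * ‖x - z‖ + dist s t * ‖B z‖ := by
      intro s t z
      wlog hst : t ≤ s generalizing s t
      · rw [dist_comm, dist_comm s]
        exact this t s (le_of_not_ge hst)
      obtain ⟨r, rfl⟩ := exists_add_of_le hst
      have hr : dist (t + r) t = r := by simp [NNReal.dist_eq]
      rw [hadd, dist_eq_norm, ← map_sub, hr]
      exact (hle _ _).trans (hosc r x z)
    refine Metric.continuous_iff.2 fun t ε hε => ?_
    obtain ⟨z, hz, hxz⟩ := hB.exists_dist_lt x (show 0 < ε / 4 by positivity)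
    refine ⟨ε / (2 * (‖B ⟨z, hz⟩‖ + 1)), by positivity, fun s hs => ?_⟩
    refine (key s t ⟨z, hz⟩).trans_lt ?_
    rw [dist_eq_norm] at hxz
    have h1 : dist s t * ‖B ⟨z, hz⟩‖ ≤ ε / 2 := by
      calc dist s t * ‖B ⟨z, hz⟩‖ ≤ ε / (2 * (‖B ⟨z, hz⟩‖ + 1)) * (‖B ⟨z, hz⟩‖ + 1) := by
            gcongr
            linarith
        _ = ε / 2 := by field_simp
    simp only at h1 ⊢
    linarith
  have hquot : ∀ (t : ℝ≥0) (x z : B.domain),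
      ‖S t x - x - (t : ℝ) • B x‖ ≤ (2 * ‖B x - z‖ + t * ‖B z‖) * t := by
    intro t x z
    have hlim : Tendsto (fun n => (‖P n x - B x‖ + (2 * ‖B x - z‖ + t * ‖P n z‖)) * t) atTop
        (𝓝 ((‖B x - B x‖ + (2 * ‖B x - z‖ + t * ‖B z‖)) * t)) :=
      ((((hPB x).sub_const _).norm).add (((hPB z).norm.const_mul _).const_add _)).mul_const _
    rw [sub_self, norm_zero, zero_add] at hlim
    refine le_of_tendsto_of_tendsto (((hS t x).sub_const _).sub_const _).norm hlim
      (Eventually.of_forall fun n => norm_exp_smul_sub_sub_le (P n) _ _ t.coe_nonneg fun s hs => ?_)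
    have e : NormedSpace.exp (s • P n) (P n x) - B x
        = NormedSpace.exp (s • P n) (P n x - B x) + (NormedSpace.exp (s • P n) (B x - z)
          + (NormedSpace.exp (s • P n) (z : X) - z) - (B x - z)) := by
      simp only [map_sub]
      abel
    rw [e]
    refine (norm_add_le _ _).trans (add_le_add (norm_exp_smul_apply_le (hP n) hs.1 _) ?_)
    have h1 := norm_sub_le (NormedSpace.exp (s • P n) (B x - z)
      + (NormedSpace.exp (s • P n) (z : X) - z)) (B x - z)
    have h2 := norm_add_le (NormedSpace.exp (s • P n) (B x - z))
      (NormedSpace.exp (s • P n) (z : X) - z)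
    have h3 := norm_exp_smul_apply_le (hP n) hs.1 (B x - z)
    have h4 := norm_exp_smul_sub_le (hP n) (z : X) hs.1
    have h5 := mul_le_mul_of_nonneg_right hs.2 (norm_nonneg (P n z))
    linarith
  refine ⟨S, ⟨?_, fun s t => ContinuousLinearMap.ext (hadd s t), hcont, fun t =>
    ContinuousLinearMap.opNorm_le_bound _ zero_le_one fun x => by simpa using hle t x⟩,
    fun x => ?_⟩
  · ext x
    refine tendsto_nhds_unique (hS 0 x) ?_
    simp
  · rw [Metric.tendsto_nhds]
    intro ε hε
    obtain ⟨z, hz, hxz⟩ := hB.exists_dist_lt (B x) (show 0 < ε / 4 by positivity)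
    rw [dist_eq_norm] at hxz
    have hsmall : ∀ᶠ h : ℝ≥0 in 𝓝[>] 0, (h : ℝ) * ‖B ⟨z, hz⟩‖ < ε / 2 := by
      have : Tendsto (fun h : ℝ≥0 => (h : ℝ) * ‖B ⟨z, hz⟩‖) (𝓝[>] 0) (𝓝 0) := by
        have h0 : Continuous fun h : ℝ≥0 => (h : ℝ) * ‖B ⟨z, hz⟩‖ := by fun_prop
        simpa using (h0.tendsto 0).mono_left nhdsWithin_le_nhds
      exact this.eventually_lt_const (by positivity)
    filter_upwards [hsmall, self_mem_nhdsWithin] with h hh hpos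
    have hpos' : (0 : ℝ) < h := NNReal.coe_pos.2 hpos
    have e : (h : ℝ)⁻¹ • (S h x - x) - B x = (h : ℝ)⁻¹ • (S h x - x - (h : ℝ) • B x) := by
      rw [smul_sub _ _ ((h : ℝ) • B x), smul_smul, inv_mul_cancel₀ hpos'.ne', one_smul]
    rw [dist_eq_norm, e, norm_smul, norm_inv, Real.norm_of_nonneg hpos'.le, inv_mul_lt_iff₀ hpos']
    refine (hquot h x ⟨z, hz⟩).trans_lt ?_
    rw [mul_comm]
    gcongr
    simp only
    linarith

/-- Hille–Yosida for non-positive operators: if `B` is densely defined and `l - B` is onto for all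
`l > 0`, the Yosida approximations `n² (n - B)⁻¹ - n` are commuting bounded non-positive operators
that converge to `B`, so that the limit of their exponentials is generated by `B`. -/
theorem IsNonpositive.exists_contractionSemigroup {B : X →ₗ.[ℝ] X} (hB : IsNonpositive B)
    (hdense : Dense (B.domain : Set X))
    (hsurj : ∀ l : ℝ, 0 < l → ∀ y, ∃ x : B.domain, l • (x : X) - B x = y) :
    ∃ S : ℝ≥0 → X →L[ℝ] X, IsContractionSemigroup S ∧ IsGenerator B S := by
  -- the parameter is `n + 1`, so that it is positive for every `n : ℕ`
  have hl : ∀ n : ℕ, (0 : ℝ) < (n : ℝ) + 1 := fun n => by positivity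
  choose R hRb hRr hRl using fun n : ℕ =>
    hB.isDissipative.exists_resolvent (hl n) (hsurj _ (hl n))
  let P : ℕ → X →L[ℝ] X := fun n =>
    ((n : ℝ) + 1) ^ 2 • R n - ((n : ℝ) + 1) • (1 : X →L[ℝ] X)
  have hPapp : ∀ n x, P n x = ((n : ℝ) + 1) ^ 2 • R n x - ((n : ℝ) + 1) • x := fun n x => rfl
  have hPnonpos : ∀ n x, inner ℝ (P n x) x ≤ 0 := by
    intro n x
    rw [hPapp, inner_sub_left, real_inner_smul_left, real_inner_smul_left,
      real_inner_self_eq_norm_sq]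
    have h1 := real_inner_le_norm (R n x) x
    have h2 := mul_le_mul_of_nonneg_right (hRb n x) (norm_nonneg x)
    have h3 : ((n : ℝ) + 1) * inner ℝ (R n x) x ≤ ‖x‖ ^ 2 := by
      have := mul_le_mul_of_nonneg_left h1 (hl n).le
      linarith [sq ‖x‖]
    have h4 := mul_le_mul_of_nonneg_left h3 (hl n).le
    linarith [sq ((n : ℝ) + 1)]
  have hRcomm : ∀ m n, Commute (R m) (R n) := by
    -- the resolvent identity `R m - R n = (n - m) R m R n`, and the same with `m`, `n` exchanged
    intro m n
    have hres : ∀ (m n : ℕ) (x : X), R m x + ((m : ℝ) - n) • R m (R n x) = R n x := by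
      intro m n x
      obtain ⟨h, e⟩ := hRr n x
      rw [← map_smul, ← map_add]
      refine Eq.trans (congrArg (R m) ?_) (hRl m ⟨R n x, h⟩)
      nth_rewrite 1 [← e]
      module
    rcases eq_or_ne m n with rfl | hmn
    · exact Commute.refl _
    have hmn' : (m : ℝ) - n ≠ 0 := sub_ne_zero.2 (Nat.cast_injective.ne hmn)
    ext x
    refine smul_right_injective X hmn' ?_
    have h1 := hres m n x
    have h2 := hres n m x
    simp only [mul_apply_eq_comp]
    rw [eq_sub_of_add_eq' h1, ← neg_sub (n : ℝ) m, neg_smul, eq_sub_of_add_eq' h2, neg_sub]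
  have hPcomm : ∀ m n, Commute (P m) (P n) := by
    intro m n
    have h1 := ((hRcomm m n).smul_left (((m : ℝ) + 1) ^ 2)).smul_right (((n : ℝ) + 1) ^ 2)
    have hone : ∀ (c : ℝ) (T : X →L[ℝ] X), Commute (c • (1 : X →L[ℝ] X)) T := fun c T =>
      (Commute.one_left T).smul_left c
    exact (h1.sub_left (hone _ _)).sub_right (hone _ _).symm
  have hPB : ∀ z : B.domain, Tendsto (fun n => P n z) atTop (𝓝 (B z)) := by
    have hlR : ∀ (n : ℕ) (z : B.domain), ((n : ℝ) + 1) • R n z = z + R n (B z) := fun n z => by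
      have h := hRl n z
      rw [map_sub, map_smul] at h
      exact sub_eq_iff_eq_add.1 h
    have htend : ∀ y, Tendsto (fun n : ℕ => ((n : ℝ) + 1) • R n y) atTop (𝓝 y) := by
      intro y
      rw [Metric.tendsto_atTop]
      intro ε hε
      obtain ⟨z, hz, hyz⟩ := hdense.exists_dist_lt y (show 0 < ε / 4 by positivity)
      rw [dist_eq_norm] at hyz
      obtain ⟨N, hN⟩ := exists_nat_gt (‖B ⟨z, hz⟩‖ / (ε / 2))
      refine ⟨N, fun n hn => ?_⟩
      have e : ((n : ℝ) + 1) • R n y - y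
          = ((n : ℝ) + 1) • R n (y - z) + R n (B ⟨z, hz⟩) - (y - z) := by
        rw [map_sub, smul_sub, hlR n ⟨z, hz⟩]
        abel
      have h1 := norm_sub_le (((n : ℝ) + 1) • R n (y - z) + R n (B ⟨z, hz⟩)) (y - z)
      have h2 := norm_add_le (((n : ℝ) + 1) • R n (y - z)) (R n (B ⟨z, hz⟩))
      rw [norm_smul, Real.norm_of_nonneg (hl n).le] at h2
      have h3 := hRb n (y - z)
      have h4 : ‖R n (B ⟨z, hz⟩)‖ ≤ ε / 2 := by
        refine le_of_mul_le_mul_left ((hRb n _).trans ?_) (hl n)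
        have hNn : (N : ℝ) ≤ n := Nat.cast_le.2 hn
        rw [div_lt_iff₀ (by positivity)] at hN
        exact hN.le.trans (by gcongr; linarith)
      rw [dist_eq_norm, e]
      linarith
    intro z
    refine (htend (B z)).congr fun n => ?_
    rw [hPapp, sq, mul_smul, hlR n z, ← smul_sub, add_sub_cancel_left]
  obtain ⟨S, hS, hext⟩ := exists_contractionSemigroup_of_tendsto hPnonpos hPcomm hdense hPB
  refine ⟨S, hS, hS.isGenerator (fun y => ?_) hext⟩
  simpa using hsurj 1 one_pos y

end HilleYosida

/-! ### Primitives and weak derivatives on the unit interval -/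

theorem integral_vol_eq (f : ℝ → ℝ) : ∫ x in Ioo (0 : ℝ) 1, f x = ∫ x in (0 : ℝ)..1, f x := by
  rw [intervalIntegral.integral_of_le zero_le_one, integral_Ioc_eq_integral_Ioo]

theorem intervalIntegrable_of_vol {f : ℝ → ℝ} (hf : Integrable f vol) :
    IntervalIntegrable f volume 0 1 := by
  rw [intervalIntegrable_iff_integrableOn_Ioc_of_le zero_le_one,
    integrableOn_Ioc_iff_integrableOn_Ioo]
  exact hf

theorem locallyIntegrableOn_of_integrable {f : ℝ → ℝ} (hf : Integrable f vol) :
    LocallyIntegrableOn f (Ioo 0 1) :=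
  IntegrableOn.locallyIntegrableOn hf

theorem absolutelyContinuous_primitive {f : ℝ → ℝ} (hf : Integrable f vol) :
    AbsolutelyContinuousOnInterval (fun x => ∫ t in (0 : ℝ)..x, f t) 0 1 :=
  (intervalIntegrable_of_vol hf).absolutelyContinuousOnInterval_intervalIntegral left_mem_uIcc

theorem continuousOn_primitive {f : ℝ → ℝ} (hf : Integrable f vol) :
    ContinuousOn (fun x => ∫ t in (0 : ℝ)..x, f t) (Icc 0 1) := by
  simpa [uIcc_of_le] using (absolutelyContinuous_primitive hf).continuousOn

theorem integrable_vol_of_continuousOn {f : ℝ → ℝ} (hf : ContinuousOn f (Icc 0 1)) :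
    Integrable f vol :=
  hf.integrableOn_Icc.mono_set Ioo_subset_Icc_self

theorem memLp_vol_of_continuousOn {f : ℝ → ℝ} (hf : ContinuousOn f (Icc 0 1)) :
    MemLp f 2 vol := by
  rw [memLp_two_iff_integrable_sq (integrable_vol_of_continuousOn hf).aestronglyMeasurable]
  exact integrable_vol_of_continuousOn (hf.pow 2)

/-- Integration by parts against a primitive. -/
theorem integral_primitive_mul_deriv {f φ : ℝ → ℝ} (hf : Integrable f vol)
    (hφ : ContDiff ℝ 1 φ) :
    ∫ x in (0 : ℝ)..1, (∫ t in (0 : ℝ)..x, f t) * deriv φ x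
      = (∫ t in (0 : ℝ)..1, f t) * φ 1 - ∫ x in (0 : ℝ)..1, f x * φ x := by
  rw [(absolutelyContinuous_primitive hf).integral_mul_deriv_eq_deriv_mul
    hφ.contDiffOn.absolutelyContinuousOnInterval]
  have e : ∫ x in (0 : ℝ)..1, deriv (fun x => ∫ t in (0 : ℝ)..x, f t) x * φ x
      = ∫ x in (0 : ℝ)..1, f x * φ x := by
    apply intervalIntegral.integral_congr_ae
    filter_upwards [(intervalIntegrable_of_vol hf).ae_hasDerivAt_integral] with x hx hx'
    rw [(hx (uIoc_subset_uIcc hx') 0 left_mem_uIcc).deriv]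
  simp [e]

theorem IsTest.apply_one {φ : ℝ → ℝ} (hφ : IsTest φ) : φ 1 = 0 :=
  image_eq_zero_of_notMem_tsupport fun h => lt_irrefl _ (hφ.tsupport_subset h).2

theorem IsTest.deriv {φ : ℝ → ℝ} (hφ : IsTest φ) : IsTest (deriv φ) := by
  simpa [iteratedDeriv_one] using hφ.iteratedDeriv 1

theorem isWeakDeriv_primitive {f : ℝ → ℝ} (hf : Integrable f vol) :
    IsWeakDeriv 1 (fun x => ∫ t in (0 : ℝ)..x, f t) f where
  left := locallyIntegrableOn_of_integrable
    (integrable_vol_of_continuousOn (continuousOn_primitive hf))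
  right := locallyIntegrableOn_of_integrable hf
  integral_eq φ hφ := by
    rw [iteratedDeriv_one, integral_vol_eq, integral_vol_eq,
      integral_primitive_mul_deriv hf (hφ.contDiff.of_le (by norm_cast)),
      hφ.apply_one]
    ring

theorem integral_primitive {f : ℝ → ℝ} (hf : Integrable f vol) :
    ∫ x in (0 : ℝ)..1, ∫ t in (0 : ℝ)..x, f t
      = (∫ t in (0 : ℝ)..1, f t) - ∫ x in (0 : ℝ)..1, f x * x := by
  simpa using integral_primitive_mul_deriv hf contDiff_id

theorem IsWeakDeriv.trans {j k : ℕ} {u v w : ℝ → ℝ} (h : IsWeakDeriv j u v)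
    (h' : IsWeakDeriv k v w) : IsWeakDeriv (j + k) u w where
  left := h.left
  right := h'.right
  integral_eq φ hφ := by
    have e : _root_.iteratedDeriv (j + k) φ
        = _root_.iteratedDeriv j (_root_.iteratedDeriv k φ) := by
      simp only [iteratedDeriv_eq_iterate, Function.iterate_add_apply]
    rw [e, h.integral_eq _ (hφ.iteratedDeriv k), h'.integral_eq φ hφ, ← mul_assoc, ← pow_add]

/-- The weak derivative of `u⁽ʲ⁾` is `u⁽ʲ⁺ᵏ⁾`. -/
theorem IsWeakDeriv.of_add {j k : ℕ} {u v w : ℝ → ℝ} (h : IsWeakDeriv j u v)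
    (h' : IsWeakDeriv (j + k) u w) : IsWeakDeriv k v w where
  left := h.right
  right := h'.right
  integral_eq φ hφ := by
    have e : _root_.iteratedDeriv (j + k) φ
        = _root_.iteratedDeriv j (_root_.iteratedDeriv k φ) := by
      simp only [iteratedDeriv_eq_iterate, Function.iterate_add_apply]
    have h1 := h'.integral_eq φ hφ
    rw [e, h.integral_eq _ (hφ.iteratedDeriv k), pow_add, mul_assoc] at h1
    exact mul_left_cancel₀ (pow_ne_zero j (by norm_num)) h1

theorem IsTest.isWeakDeriv_deriv {φ : ℝ → ℝ} (hφ : IsTest φ) :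
    IsWeakDeriv 1 φ (_root_.deriv φ) := by
  have hd : Integrable (_root_.deriv φ) vol :=
    integrable_vol_of_continuousOn hφ.deriv.contDiff.continuous.continuousOn
  have h0 : φ 0 = 0 :=
    image_eq_zero_of_notMem_tsupport fun h => lt_irrefl _ (hφ.tsupport_subset h).1
  have e : (fun x => ∫ t in (0 : ℝ)..x, _root_.deriv φ t) = φ := by
    funext x
    rw [intervalIntegral.integral_deriv_eq_sub, h0, sub_zero]
    · exact fun y _ => (hφ.contDiff.differentiable (by simp)).differentiableAt
    · exact hφ.deriv.contDiff.continuous.intervalIntegrable _ _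
  have h := isWeakDeriv_primitive hd
  rwa [e] at h

/-- A function with integrable weak derivative `g` and zero boundary values is the primitive of
`g`, and `g` has mean zero. -/
theorem HasZeroTrace.ae_eq_primitive {f g : ℝ → ℝ} (hf : HasZeroTrace f)
    (h : IsWeakDeriv 1 f g) (hg : Integrable g vol) :
    f =ᵐ[vol] (fun x => ∫ t in (0 : ℝ)..x, g t) ∧ ∫ t in (0 : ℝ)..1, g t = 0 := by
  obtain ⟨F, hF, hfF, hF0, hF1⟩ := hf
  set G : ℝ → ℝ := fun x => ∫ t in (0 : ℝ)..x, g t with hG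
  have hGc : ContinuousOn G (Icc 0 1) := continuousOn_primitive hg
  have hd := h.add ((isWeakDeriv_primitive hg).smul (-1))
  obtain ⟨c, hc⟩ := ae_eq_const_of_weakDeriv_zero hd.left fun φ hφ => by
    have e := hd.integral_eq φ hφ
    simpa [iteratedDeriv_one] using e
  have hFG : (F - G) =ᵐ[volume.restrict (Ioo 0 1)] fun _ => c := by
    filter_upwards [hc, hfF] with x h1 h2
    simp only [Pi.add_apply, Pi.smul_apply, smul_eq_mul, neg_mul, one_mul] at h1
    rw [Pi.sub_apply, ← h2, ← h1, sub_eq_add_neg]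
  have hcont : ContinuousOn (F - G) (Icc 0 1) := hF.sub hGc
  have hEq : EqOn (F - G) (fun _ => c) (Icc 0 1) :=
    (Measure.eqOn_open_of_ae_eq hFG isOpen_Ioo (hcont.mono Ioo_subset_Icc_self)
      continuousOn_const).of_subset_closure hcont continuousOn_const Ioo_subset_Icc_self
      (by rw [closure_Ioo zero_ne_one])
  have hc0 : c = 0 := by
    refine (hEq (left_mem_Icc.2 zero_le_one)).symm.trans ?_
    simp [hF0, hG]
  have h1 := hEq (right_mem_Icc.2 zero_le_one)
  simp only [Pi.sub_apply, hF1, hc0, zero_sub, neg_eq_zero] at h1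
  refine ⟨?_, h1⟩
  filter_upwards [hFG, hfF] with x h1 h2
  rw [Pi.sub_apply, hc0, sub_eq_zero] at h1
  rw [h2, h1]

/-- `u ∈ H²₀(0,1)` is the second primitive of `u''`, and `u''` is orthogonal to the affine
functions. -/
theorem MemH20.ae_eq_primitive {u w : ℝ → ℝ} (hu : MemH20 u) (h : IsWeakDeriv 2 u w)
    (hw : MemLp w 2 vol) :
    u =ᵐ[vol] (fun x => ∫ s in (0 : ℝ)..x, ∫ t in (0 : ℝ)..s, w t) ∧
      ∫ t in (0 : ℝ)..1, w t = 0 ∧ ∫ t in (0 : ℝ)..1, w t * t = 0 := by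
  obtain ⟨-, ht, ⟨u₁, -, h1, ht1⟩, -⟩ := hu
  have hwi : Integrable w vol := hw.integrable one_le_two
  obtain ⟨e1, z1⟩ := ht1.ae_eq_primitive (h1.of_add h) hwi
  have hG : Integrable (fun x => ∫ t in (0 : ℝ)..x, w t) vol :=
    integrable_vol_of_continuousOn (continuousOn_primitive hwi)
  obtain ⟨e0, z0⟩ := ht.ae_eq_primitive (h1.congr EventuallyEq.rfl e1) hG
  rw [integral_primitive hwi, z1, zero_sub, neg_eq_zero] at z0
  exact ⟨e0, z1, z0⟩

/-- Every `w ∈ L²(0,1)` orthogonal to the affine functions is the second derivative of a function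
of `H²₀(0,1)`. -/
theorem memH20_primitive {w : ℝ → ℝ} (hw : MemLp w 2 vol) (h0 : ∫ t in (0 : ℝ)..1, w t = 0)
    (h1 : ∫ t in (0 : ℝ)..1, w t * t = 0) :
    MemH20 (fun x => ∫ s in (0 : ℝ)..x, ∫ t in (0 : ℝ)..s, w t) ∧
      IsWeakDeriv 2 (fun x => ∫ s in (0 : ℝ)..x, ∫ t in (0 : ℝ)..s, w t) w := by
  have hwi : Integrable w vol := hw.integrable one_le_two
  have hGc := continuousOn_primitive hwi
  have hG := integrable_vol_of_continuousOn hGc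
  have hUc := continuousOn_primitive hG
  have d1 := isWeakDeriv_primitive hwi
  have d0 := isWeakDeriv_primitive hG
  refine ⟨⟨memLp_vol_of_continuousOn hUc,
    ⟨_, hUc, EventuallyEq.rfl, intervalIntegral.integral_same, ?_⟩,
    ⟨_, memLp_vol_of_continuousOn hGc, d0,
      ⟨_, hGc, EventuallyEq.rfl, intervalIntegral.integral_same, h0⟩⟩,
    w, hw, d0.trans d1⟩, d0.trans d1⟩
  rw [integral_primitive hwi, h0, h1, sub_zero]

theorem IsTest.hasZeroTrace {φ : ℝ → ℝ} (hφ : IsTest φ) : HasZeroTrace φ :=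
  ⟨φ, hφ.contDiff.continuous.continuousOn, EventuallyEq.rfl,
    image_eq_zero_of_notMem_tsupport fun h => lt_irrefl _ (hφ.tsupport_subset h).1, hφ.apply_one⟩

theorem IsTest.isWeakDeriv_two {φ : ℝ → ℝ} (hφ : IsTest φ) :
    IsWeakDeriv 2 φ (_root_.iteratedDeriv 2 φ) := by
  have h := hφ.isWeakDeriv_deriv.trans hφ.deriv.isWeakDeriv_deriv
  rwa [iteratedDeriv_succ, iteratedDeriv_one]

theorem IsTest.memLp {φ : ℝ → ℝ} (hφ : IsTest φ) : MemLp φ 2 vol :=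
  memLp_vol_of_continuousOn hφ.contDiff.continuous.continuousOn

theorem IsTest.memH20 {φ : ℝ → ℝ} (hφ : IsTest φ) : MemH20 φ :=
  ⟨hφ.memLp, hφ.hasZeroTrace,
    ⟨_, hφ.deriv.memLp, hφ.isWeakDeriv_deriv, hφ.deriv.hasZeroTrace⟩,
    _, (hφ.iteratedDeriv 2).memLp, hφ.isWeakDeriv_two⟩

/-- A function whose second distributional derivative vanishes is affine. -/
theorem ae_eq_affine_of_integral_iteratedDeriv_two {f : ℝ → ℝ}
    (hf : LocallyIntegrableOn f (Ioo 0 1))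
    (h : ∀ φ, IsTest φ → ∫ x in Ioo (0 : ℝ) 1, f x * iteratedDeriv 2 φ x = 0) :
    ∃ b c : ℝ, f =ᵐ[vol] fun x => b + c * x := by
  obtain ⟨ψ, hψ, hψ1⟩ := exists_isTest_integral_eq_one
  set c := -∫ x in Ioo (0 : ℝ) 1, f x * deriv ψ x with hc
  have hid : LocallyIntegrableOn (fun x : ℝ => c * x) (Ioo 0 1) :=
    (by fun_prop : Continuous fun x : ℝ => c * x).locallyIntegrable.locallyIntegrableOn _
  have hint : ∀ φ, IsTest φ → Integrable φ vol := fun φ hφ => hφ.memLp.integrable one_le_two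
  obtain ⟨b, hb⟩ := ae_eq_const_of_weakDeriv_zero (hf.sub hid) fun φ hφ => by
    -- `φ - (∫ φ) ψ` is the derivative of a test function
    set m := ∫ x in Ioo (0 : ℝ) 1, φ x with hm
    obtain ⟨Φ, hΦ, hΦ'⟩ := (hφ.add (hψ.const_mul (-m))).exists_deriv_eq (by
      simp only [Pi.add_apply]
      rw [integral_add (hint φ hφ) ((hint ψ hψ).const_mul _), integral_const_mul, hψ1]
      simp [hm])
    have e2 : iteratedDeriv 2 Φ = fun x => deriv φ x + (-m) * deriv ψ x := by
      rw [iteratedDeriv_succ, iteratedDeriv_one, hΦ']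
      funext x
      have dφ := (hφ.contDiff.differentiable (by simp)) x
      have dψ := (hψ.contDiff.differentiable (by simp)) x
      rw [deriv_add dφ (dψ.const_mul _), deriv_const_mul _ dψ]
    have e := h Φ hΦ
    rw [e2] at e
    have e' : ∫ x in Ioo (0 : ℝ) 1, (f x * deriv φ x + (-m) * (f x * deriv ψ x)) = 0 := by
      refine Eq.trans ?_ e
      exact integral_congr_ae (ae_of_all _ fun x => by ring)
    rw [integral_add (hφ.deriv.integrable_mul hf) ((hψ.deriv.integrable_mul hf).const_mul _),
      integral_const_mul] at e'
    have ex : ∫ x in Ioo (0 : ℝ) 1, x * deriv φ x = -m := by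
      have := integral_primitive_mul_deriv (f := fun _ => 1) (integrable_const (1 : ℝ))
        (hφ.contDiff.of_le (by norm_cast))
      rw [hφ.apply_one, mul_zero, zero_sub] at this
      simpa [integral_vol_eq, hm] using this
    simp only [Pi.sub_apply, sub_mul]
    rw [integral_sub (hφ.deriv.integrable_mul hf) (hφ.deriv.integrable_mul hid)]
    simp only [mul_assoc]
    rw [integral_const_mul, ex]
    linear_combination e' + m * hc
  refine ⟨b, c, ?_⟩
  filter_upwards [hb] with x hx
  rw [Pi.sub_apply, sub_eq_iff_eq_add] at hx
  exact hx

/-- Cauchy–Schwarz: a primitive of `w ∈ L²(0,1)` is `O(√x)` at the origin. -/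
theorem abs_primitive_le (w : Lp ℝ 2 vol) {x : ℝ} (hx : x ∈ Icc (0 : ℝ) 1) :
    |∫ t in (0 : ℝ)..x, w t| ≤ ‖w‖ * √x := by
  have hs : MeasurableSet (Ioo 0 x) := measurableSet_Ioo
  have hfin : vol (Ioo 0 x) ≠ ⊤ := measure_ne_top _ _
  have hr : vol.restrict (Ioo 0 x) = volume.restrict (Ioo 0 x) :=
    Measure.restrict_restrict_of_subset (Ioo_subset_Ioo_right hx.2)
  have e : ∫ t in (0 : ℝ)..x, w t = inner ℝ (indicatorConstLp 2 hs hfin (1 : ℝ)) w := by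
    rw [L2.inner_indicatorConstLp_one, hr, intervalIntegral.integral_of_le hx.1,
      integral_Ioc_eq_integral_Ioo]
  rw [e]
  refine (abs_real_inner_le_norm _ _).trans ?_
  rw [norm_indicatorConstLp (by norm_num) (by norm_num), mul_comm]
  have hv : vol.real (Ioo 0 x) = x := by
    rw [Measure.real, Measure.restrict_apply hs,
      inter_eq_left.2 (Ioo_subset_Ioo_right hx.2), Real.volume_Ioo, sub_zero,
      ENNReal.toReal_ofReal hx.1]
  rw [hv, norm_one, one_mul, Real.sqrt_eq_rpow]
  norm_num

theorem sq_primitive_primitive_le (w : Lp ℝ 2 vol) {x : ℝ} (hx : x ∈ Icc (0 : ℝ) 1) :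
    (∫ s in (0 : ℝ)..x, ∫ t in (0 : ℝ)..s, w t) ^ 2 ≤ x ^ 3 * ‖w‖ ^ 2 := by
  have h : ‖∫ s in (0 : ℝ)..x, ∫ t in (0 : ℝ)..s, w t‖ ≤ ‖w‖ * √x * |x - 0| := by
    refine intervalIntegral.norm_integral_le_of_norm_le_const fun s hs => ?_
    rw [uIoc_of_le hx.1] at hs
    refine (abs_primitive_le w ⟨hs.1.le, hs.2.trans hx.2⟩).trans ?_
    gcongr
    exact hs.2
  rw [sub_zero, abs_of_nonneg hx.1, Real.norm_eq_abs] at h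
  calc _ = |∫ s in (0 : ℝ)..x, ∫ t in (0 : ℝ)..s, w t| ^ 2 := (sq_abs _).symm
    _ ≤ (‖w‖ * √x * x) ^ 2 := by gcongr
    _ = √x ^ 2 * x ^ 2 * ‖w‖ ^ 2 := by ring
    _ = x ^ 3 * ‖w‖ ^ 2 := by
      rw [Real.sq_sqrt hx.1]
      ring

/-! ### The weighted space -/

section Weighted

variable {a : ℝ → ℝ}

theorem IsDegenerateCoefficient.pos_of_mem_Ioo (ha : IsDegenerateCoefficient a) {x : ℝ}
    (hx : x ∈ Ioo (0 : ℝ) 1) : 0 < a x :=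
  ha.pos x ⟨hx.1, hx.2.le⟩

theorem IsDegenerateCoefficient.aemeasurable (ha : IsDegenerateCoefficient a) :
    AEMeasurable a vol :=
  (ha.continuousOn.mono Ioo_subset_Icc_self).aemeasurable measurableSet_Ioo

theorem IsDegenerateCoefficient.continuousOn_inv (ha : IsDegenerateCoefficient a) :
    ContinuousOn (fun x => 1 / a x) (Ioo 0 1) :=
  continuousOn_const.div (ha.continuousOn.mono Ioo_subset_Icc_self)
    fun _ hx => (ha.pos_of_mem_Ioo hx).ne'

theorem IsDegenerateCoefficient.locallyIntegrableOn_inv (ha : IsDegenerateCoefficient a) :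
    LocallyIntegrableOn (fun x => 1 / a x) (Ioo 0 1) :=
  ha.continuousOn_inv.locallyIntegrableOn measurableSet_Ioo

/-- Near the origin `1 / a x ≤ C x ^ (-K)` with `K < 2`, and elsewhere `a` is bounded below. -/
theorem IsDegenerateCoefficient.exists_bound (ha : IsDegenerateCoefficient a) :
    ∃ M, 0 ≤ M ∧ ∀ x ∈ Ioo (0 : ℝ) 1, x ^ 3 / a x ≤ M := by
  obtain ⟨K, hK, ε, hε, hmono⟩ := ha.monotone_near_zero
  have hc : ContinuousOn (fun x => x ^ 3 / a x) (Icc ε 1) :=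
    (continuousOn_pow 3).div (ha.continuousOn.mono (Icc_subset_Icc_left hε.1.le))
      fun x hx => (ha.pos x ⟨hε.1.trans_le hx.1, hx.2⟩).ne'
  obtain ⟨M, hM⟩ := isCompact_Icc.exists_bound_of_continuousOn hc
  refine ⟨max M (ε ^ K / a ε), le_max_of_le_left
    ((norm_nonneg _).trans (hM ε (left_mem_Icc.2 hε.2))), fun x hx => ?_⟩
  rcases le_total ε x with h | h
  · exact le_max_of_le_left ((le_abs_self _).trans (hM x ⟨h, hx.2.le⟩))
  · refine le_max_of_le_right (le_trans ?_ (hmono ⟨hx.1, h⟩ ⟨hε.1, le_rfl⟩ h))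
    have hax := ha.pos_of_mem_Ioo hx
    have h3 : x ^ (3 : ℕ) ≤ x ^ K := by
      rw [← Real.rpow_natCast]
      refine Real.rpow_le_rpow_of_exponent_ge hx.1 hx.2.le ?_
      push_cast
      linarith [hK.2]
    exact div_le_div_of_nonneg_right h3 hax.le

theorem weight_lt_top : ∀ᵐ x ∂vol, ENNReal.ofReal (1 / a x) < ⊤ :=
  ae_of_all _ fun _ => ENNReal.ofReal_lt_top

theorem IsDegenerateCoefficient.weight_smul_ae_eq (ha : IsDegenerateCoefficient a)
    (f : ℝ → ℝ) :
    (fun x => (ENNReal.ofReal (1 / a x)).toReal • f x) =ᵐ[vol] fun x => f x / a x := by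
  refine (ae_restrict_iff' measurableSet_Ioo).2 (ae_of_all _ fun x hx => ?_)
  have := ha.pos_of_mem_Ioo hx
  simp only
  rw [ENNReal.toReal_ofReal (by positivity), smul_eq_mul]
  ring

theorem IsDegenerateCoefficient.integral_weighted (ha : IsDegenerateCoefficient a)
    (f : ℝ → ℝ) : ∫ x, f x ∂weightedMeasure a = ∫ x in Ioo (0 : ℝ) 1, f x / a x := by
  rw [weightedMeasure, integral_withDensity_eq_integral_toReal_smul₀
    (ha.aemeasurable.const_div 1).ennreal_ofReal weight_lt_top]
  exact integral_congr_ae (ha.weight_smul_ae_eq f)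

theorem IsDegenerateCoefficient.integrable_weighted_iff (ha : IsDegenerateCoefficient a)
    {f : ℝ → ℝ} : Integrable f (weightedMeasure a) ↔ Integrable (fun x => f x / a x) vol := by
  rw [weightedMeasure, integrable_withDensity_iff_integrable_smul₀'
    (ha.aemeasurable.const_div 1).ennreal_ofReal weight_lt_top]
  exact integrable_congr (ha.weight_smul_ae_eq f)

theorem IsDegenerateCoefficient.memLp_weighted_iff (ha : IsDegenerateCoefficient a)
    {f : ℝ → ℝ} (hf : AEStronglyMeasurable f vol) :
    MemLp f 2 (weightedMeasure a) ↔ Integrable (fun x => f x ^ 2 / a x) vol := by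
  rw [memLp_two_iff_integrable_sq (hf.mono_ac (weightedMeasure_ac a)),
    ha.integrable_weighted_iff]

/-- `∫ h k dμ = ∫ h k / a dx` in `L²_{1/a}(0,1)`, for any versions of the two classes. -/
theorem IsDegenerateCoefficient.inner_weighted (ha : IsDegenerateCoefficient a) (h k : L2w a)
    {f : ℝ → ℝ} (hk : k =ᵐ[vol] f) :
    inner ℝ h k = ∫ x in Ioo (0 : ℝ) 1, h x / a x * f x := by
  rw [L2.inner_def, ha.integral_weighted]
  refine integral_congr_ae (hk.mono fun x hx => ?_)
  simp only [hx, RCLike.inner_apply, conj_trivial]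
  ring

theorem IsDegenerateCoefficient.locallyIntegrableOn_div (ha : IsDegenerateCoefficient a)
    (h : L2w a) : LocallyIntegrableOn (fun x => h x / a x) (Ioo 0 1) := by
  have hm : AEStronglyMeasurable h vol :=
    (Lp.aestronglyMeasurable h).mono_ac (ac_weightedMeasure ha)
  have h2 := (ha.memLp_weighted_iff hm).1 (Lp.memLp h)
  -- `|h| / a ≤ (h² + 1) / a`
  have hs := (locallyIntegrableOn_of_integrable h2).add ha.locallyIntegrableOn_inv
  intro x hx
  obtain ⟨U, hU, hUi⟩ := hs x hx
  have hU' : U ∩ Ioo 0 1 ∈ 𝓝[Ioo 0 1] x := inter_mem hU self_mem_nhdsWithin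
  refine ⟨U ∩ Ioo 0 1, hU', ?_⟩
  have hi := hUi.mono_set (inter_subset_left (t := Ioo (0 : ℝ) 1))
  refine Integrable.mono hi ?_ ?_
  · exact ((hm.aemeasurable.div ha.aemeasurable).aestronglyMeasurable).mono_measure
      (Measure.restrict_mono inter_subset_right le_rfl)
  · have : ∀ᵐ y ∂volume.restrict (U ∩ Ioo (0 : ℝ) 1), y ∈ Ioo (0 : ℝ) 1 :=
      ae_mono (Measure.restrict_mono inter_subset_right le_rfl)
        (ae_restrict_mem measurableSet_Ioo)
    filter_upwards [this] with y hy
    have hay := ha.pos_of_mem_Ioo hy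
    simp only [Pi.add_apply, norm_div, Real.norm_eq_abs]
    rw [← add_div, abs_div, abs_of_pos hay,
      abs_of_nonneg (by positivity : (0 : ℝ) ≤ h y ^ 2 + 1)]
    refine div_le_div_of_nonneg_right ?_ hay.le
    nlinarith [sq_abs (h y), sq_nonneg (|h y| - 1), abs_nonneg (h y)]

/-! ### The space `H²_{1/a}(0,1)` -/

theorem integrable_of_Lp (w : Lp ℝ 2 vol) : Integrable w vol :=
  (Lp.memLp w).integrable one_le_two

/-- The pointwise form `u² / a ≤ M ∫ (u'')²` of a Hardy-type inequality. It shows that functions of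
`H²₀(0,1)` automatically belong to `L²_{1/a}(0,1)`. -/
theorem sq_div_le_of_bound (ha : IsDegenerateCoefficient a) {M : ℝ}
    (hM : ∀ x ∈ Ioo (0 : ℝ) 1, x ^ 3 / a x ≤ M) {u : ℝ → ℝ} (hu : MemH20 u) (w : Lp ℝ 2 vol)
    (h : IsWeakDeriv 2 u w) : ∀ᵐ x ∂vol, u x ^ 2 / a x ≤ M * ‖w‖ ^ 2 := by
  filter_upwards [(hu.ae_eq_primitive h (Lp.memLp w)).1, ae_restrict_mem measurableSet_Ioo]
    with x hx hmem
  have hax := ha.pos_of_mem_Ioo hmem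
  have h1 := sq_primitive_primitive_le w (Ioo_subset_Icc_self hmem)
  rw [hx]
  calc _ ≤ x ^ 3 * ‖w‖ ^ 2 / a x := by gcongr
    _ = x ^ 3 / a x * ‖w‖ ^ 2 := by ring
    _ ≤ M * ‖w‖ ^ 2 := by gcongr; exact hM x hmem

theorem integrable_sq_div (ha : IsDegenerateCoefficient a) {u : ℝ → ℝ} (hu : MemH20 u) :
    Integrable (fun x => u x ^ 2 / a x) vol := by
  obtain ⟨-, -, -, w, hw, h⟩ := id hu
  obtain ⟨M, -, hM⟩ := ha.exists_bound
  have hb := sq_div_le_of_bound ha hM hu (hw.toLp w)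
    (h.congr EventuallyEq.rfl hw.coeFn_toLp.symm)
  refine Integrable.of_bound
    ((hu.1.aestronglyMeasurable.aemeasurable.pow_const 2).div ha.aemeasurable).aestronglyMeasurable
    (M * ‖hw.toLp w‖ ^ 2) ?_
  filter_upwards [hb, ae_restrict_mem measurableSet_Ioo] with x hx hmem
  have hax := ha.pos_of_mem_Ioo hmem
  rwa [Real.norm_of_nonneg (by positivity)]

namespace H2w

theorem exists_of_memH20 (ha : IsDegenerateCoefficient a) {u w : ℝ → ℝ} (hu : MemH20 u)
    (h : IsWeakDeriv 2 u w) : ∃ v : H2w a, toL2 v =ᵐ[vol] u ∧ deriv2 v =ᵐ[vol] w := by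
  have e : hu.1.toLp u =ᵐ[vol] u := hu.1.coeFn_toLp
  have hmem : hu.1.toLp u ∈ H2wSubmodule a :=
    ⟨((ha.memLp_weighted_iff hu.1.aestronglyMeasurable).2 (integrable_sq_div ha hu)).ae_eq
      ((weightedMeasure_ac a).ae_eq e.symm), hu.congr e.symm⟩
  let v : H2w a := ⟨hu.1.toLp u, hmem⟩
  have hv : toL2 v =ᵐ[vol] u := e
  exact ⟨v, hv, (isWeakDeriv_deriv2 v).unique (h.congr hv.symm EventuallyEq.rfl)⟩

theorem exists_of_isTest (ha : IsDegenerateCoefficient a) {φ : ℝ → ℝ} (hφ : IsTest φ) :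
    ∃ v : H2w a, toL2 v =ᵐ[vol] φ ∧ deriv2 v =ᵐ[vol] iteratedDeriv 2 φ :=
  exists_of_memH20 ha hφ.memH20 hφ.isWeakDeriv_two

theorem inner_eq (u v : H2w a) : inner ℝ u v = inner ℝ (deriv2 u) (deriv2 v) :=
  integral_deriv2_mul u v

theorem norm_deriv2 (u : H2w a) : ‖deriv2 u‖ = ‖u‖ := by
  rw [norm_eq_sqrt_real_inner, norm_eq_sqrt_real_inner, inner_eq]

theorem integral_deriv2 (u : H2w a) :
    ∫ t in (0 : ℝ)..1, deriv2 u t = 0 ∧ ∫ t in (0 : ℝ)..1, deriv2 u t * t = 0 :=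
  ((memH20 u).ae_eq_primitive (isWeakDeriv_deriv2 u) (Lp.memLp _)).2

/-- The isometry `u ↦ u''` identifies `H²_{1/a}(0,1)` with the orthogonal complement of the affine
functions in `L²(0,1)`. -/
theorem range_deriv2 (ha : IsDegenerateCoefficient a) :
    range (deriv2 (a := a)) =
      {w | ∫ t in (0 : ℝ)..1, w t = 0 ∧ ∫ t in (0 : ℝ)..1, w t * t = 0} := by
  ext w
  refine ⟨?_, fun ⟨h0, h1⟩ => ?_⟩
  · rintro ⟨u, rfl⟩
    exact integral_deriv2 u
  · obtain ⟨hU, hd⟩ := memH20_primitive (Lp.memLp w) h0 h1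
    obtain ⟨v, -, hv⟩ := exists_of_memH20 ha hU hd
    exact ⟨v, Lp.ext hv⟩

theorem isClosed_range_deriv2 (ha : IsDegenerateCoefficient a) :
    IsClosed (range (deriv2 (a := a))) := by
  have key : ∀ p : ℝ → ℝ, Continuous p →
      IsClosed {w : Lp ℝ 2 vol | ∫ t in (0 : ℝ)..1, w t * p t = 0} := by
    intro p hp
    have hm := memLp_vol_of_continuousOn hp.continuousOn
    have e : ∀ w : Lp ℝ 2 vol, ∫ t in (0 : ℝ)..1, w t * p t = inner ℝ (hm.toLp p) w := by
      intro w
      rw [L2.inner_def, ← integral_vol_eq]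
      refine integral_congr_ae (hm.coeFn_toLp.mono fun x hx => ?_)
      simp [hx]
    simp only [e]
    exact isClosed_eq (by fun_prop) continuous_const
  rw [range_deriv2 ha, ofPred_and]
  refine IsClosed.inter ?_ (key _ continuous_id)
  simpa using key _ (continuous_const (y := (1 : ℝ)))

theorem completeSpace (ha : IsDegenerateCoefficient a) : CompleteSpace (H2w a) := by
  let i : H2w a →ₗᵢ[ℝ] Lp ℝ 2 vol := ⟨deriv2, norm_deriv2⟩
  exact i.isometry.isUniformInducing.completeSpace (isClosed_range_deriv2 ha).isComplete

/-- Test functions are dense in `H²_{1/a}(0,1)`: if `u''` is orthogonal to all `φ''`, it is affine,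
and it is orthogonal to the affine functions. -/
theorem eq_zero_of_inner_test (u : H2w a)
    (h : ∀ φ, IsTest φ → ∫ x in Ioo (0 : ℝ) 1, deriv2 u x * iteratedDeriv 2 φ x = 0) : u = 0 := by
  have hi := integrable_of_Lp (deriv2 u)
  obtain ⟨b, c, hbc⟩ :=
    ae_eq_affine_of_integral_iteratedDeriv_two (locallyIntegrableOn_of_integrable hi) h
  obtain ⟨h0, h1⟩ := integral_deriv2 u
  have hi' : IntervalIntegrable (deriv2 u) volume 0 1 := intervalIntegrable_of_vol hi
  have hz : inner ℝ u u = (0 : ℝ) := by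
    have e : inner ℝ u u = ∫ x in Ioo (0 : ℝ) 1, (b * deriv2 u x + c * (deriv2 u x * x)) := by
      refine integral_congr_ae (hbc.mono fun x hx => ?_)
      simp only
      nth_rewrite 2 [hx]
      ring
    rw [e, integral_vol_eq, intervalIntegral.integral_add (hi'.const_mul b)
      ((hi'.mul_continuousOn (continuousOn_id' _)).const_mul c),
      intervalIntegral.integral_const_mul, intervalIntegral.integral_const_mul, h0, h1]
    simp
  exact inner_self_eq_zero.1 hz

theorem exists_norm_toL2w_le (ha : IsDegenerateCoefficient a) :
    ∃ C, ∀ u : H2w a, ‖toL2w u‖ ≤ C * ‖u‖ := by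
  obtain ⟨M, hM0, hM⟩ := ha.exists_bound
  refine ⟨√M, fun u => ?_⟩
  have e : ‖toL2w u‖ ^ 2 = ∫ x in Ioo (0 : ℝ) 1, toL2 u x ^ 2 / a x := by
    have hu := (ac_weightedMeasure ha).ae_eq (coeFn_toL2w u)
    rw [← real_inner_self_eq_norm_sq, ha.inner_weighted _ _ hu]
    refine integral_congr_ae (hu.mono fun x hx => ?_)
    simp only [hx]
    ring
  have hle : ‖toL2w u‖ ^ 2 ≤ M * ‖u‖ ^ 2 := by
    rw [e]
    calc _ ≤ ∫ x in Ioo (0 : ℝ) 1, M * ‖deriv2 u‖ ^ 2 :=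
          integral_mono_ae (integrable_sq_div ha (memH20 u)) (integrable_const _)
            (sq_div_le_of_bound ha hM (memH20 u) _ (isWeakDeriv_deriv2 u))
      _ = M * ‖u‖ ^ 2 := by simp [norm_deriv2]
  refine (sq_le_sq₀ (norm_nonneg _) (by positivity)).1 ?_
  rwa [mul_pow, Real.sq_sqrt hM0]

/-- The bounded inclusion `H²_{1/a}(0,1) → L²_{1/a}(0,1)`. -/
noncomputable def toL2wCLM (ha : IsDegenerateCoefficient a) : H2w a →L[ℝ] L2w a :=
  toL2w.mkContinuous (exists_norm_toL2w_le ha).choose (exists_norm_toL2w_le ha).choose_spec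

@[simp]
theorem toL2wCLM_apply (ha : IsDegenerateCoefficient a) (u : H2w a) :
    toL2wCLM ha u = toL2w u := rfl

theorem inner_toL2w_eq_integral (ha : IsDegenerateCoefficient a) (k : L2w a) {v : H2w a}
    {φ : ℝ → ℝ} (hv : toL2 v =ᵐ[vol] φ) :
    inner ℝ k (toL2w v) = ∫ x in Ioo (0 : ℝ) 1, k x / a x * φ x :=
  ha.inner_weighted _ _ (((ac_weightedMeasure ha).ae_eq (coeFn_toL2w v)).trans hv)

theorem inner_eq_integral (u : H2w a) {v : H2w a} {φ : ℝ → ℝ}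
    (hv : deriv2 v =ᵐ[vol] iteratedDeriv 2 φ) :
    inner ℝ u v = ∫ x in Ioo (0 : ℝ) 1, deriv2 u x * iteratedDeriv 2 φ x :=
  integral_congr_ae (hv.mono fun x hx => by simp only [hx])

theorem eq_zero_of_inner_toL2w (ha : IsDegenerateCoefficient a) (k : L2w a)
    (h : ∀ v : H2w a, inner ℝ k (toL2w v) = (0 : ℝ)) : k = 0 := by
  rw [Lp.eq_zero_iff_ae_eq_zero]
  apply (weightedMeasure_ac a).ae_eq
  have hz : (fun x => k x / a x) =ᵐ[vol] 0 :=
    ae_eq_zero_of_test (ha.locallyIntegrableOn_div k) fun φ hφ => by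
      obtain ⟨v, hv, -⟩ := exists_of_isTest ha hφ
      rw [← inner_toL2w_eq_integral ha k hv]
      exact h v
  filter_upwards [hz, ae_restrict_mem measurableSet_Ioo] with x hx hmem
  exact (div_eq_zero_iff.1 hx).resolve_right (ha.pos_of_mem_Ioo hmem).ne'

end H2w

theorem IsTest.integral_deriv2_mul {u : H2w a} {φ : ℝ → ℝ} (hφ : IsTest φ) :
    ∫ x in Ioo (0 : ℝ) 1, H2w.deriv2 u x * _root_.iteratedDeriv 2 φ x
      = ∫ x in Ioo (0 : ℝ) 1, H2w.toL2 u x * _root_.iteratedDeriv 4 φ x := by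
  have h := (H2w.isWeakDeriv_deriv2 u).integral_eq _ (hφ.iteratedDeriv 2)
  have e : _root_.iteratedDeriv 2 (_root_.iteratedDeriv 2 φ) = _root_.iteratedDeriv 4 φ := by
    simp only [iteratedDeriv_eq_iterate, ← Function.iterate_add_apply]
  rw [e] at h
  rw [h]
  norm_num

/-- The Gauss–Green formula `∫ (a u'''') v / a = ∫ u'' v''` characterises the graph of `A`: testing
with `C_c^∞` functions gives the weak fourth derivative, and these are dense in `H²_{1/a}(0,1)`. -/
theorem mem_graph_opA_iff (ha : IsDegenerateCoefficient a) (u : H2w a) (k : L2w a) :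
    (∃ hu : u ∈ (opA a).domain, opA a ⟨u, hu⟩ = k) ↔
      ∀ v : H2w a, inner ℝ u v = (inner ℝ k (H2w.toL2w v) : ℝ) := by
  have hcomplete := H2w.completeSpace ha
  constructor
  · rintro ⟨⟨w, hw⟩, rfl⟩ v
    set k := opA a ⟨u, ⟨w, hw⟩⟩ with hk
    have hkw : k =ᵐ[vol] fun x => a x * w x := by
      rw [hk, opA_apply _ hw]
      exact (ac_weightedMeasure ha).ae_eq hw.2.coeFn_toLp
    have hz : u - ContinuousLinearMap.adjoint (H2w.toL2wCLM ha) k = 0 := by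
      apply H2w.eq_zero_of_inner_test
      intro φ hφ
      obtain ⟨v, hv, hv2⟩ := H2w.exists_of_isTest ha hφ
      rw [← H2w.inner_eq_integral _ hv2, inner_sub_left, ContinuousLinearMap.adjoint_inner_left,
        H2w.toL2wCLM_apply, H2w.inner_eq_integral _ hv2, H2w.inner_toL2w_eq_integral ha k hv,
        hφ.integral_deriv2_mul, hw.1.integral_eq φ hφ, sub_eq_zero]
      norm_num
      refine integral_congr_ae ?_
      filter_upwards [hkw, ae_restrict_mem measurableSet_Ioo] with x hx hmem
      rw [hx, mul_div_cancel_left₀ _ (ha.pos_of_mem_Ioo hmem).ne']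
    rw [sub_eq_zero.1 hz, ContinuousLinearMap.adjoint_inner_left, H2w.toL2wCLM_apply]
  · intro h
    have hae : (fun x => a x * (k x / a x)) =ᵐ[weightedMeasure a] k := by
      refine (weightedMeasure_ac a).ae_eq ?_
      filter_upwards [ae_restrict_mem measurableSet_Ioo] with x hmem
      exact mul_div_cancel₀ _ (ha.pos_of_mem_Ioo hmem).ne'
    have hadm : IsAdmissibleDeriv4 a u fun x => k x / a x := by
      refine ⟨⟨(H2w.isWeakDeriv_deriv2 u).left, ha.locallyIntegrableOn_div k, fun φ hφ => ?_⟩,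
        (Lp.memLp k).ae_eq hae.symm⟩
      obtain ⟨v, hv, hv2⟩ := H2w.exists_of_isTest ha hφ
      rw [← hφ.integral_deriv2_mul, ← H2w.inner_eq_integral _ hv2, h v,
        H2w.inner_toL2w_eq_integral ha k hv]
      norm_num
    refine ⟨⟨_, hadm⟩, ?_⟩
    rw [opA_apply _ hadm]
    exact Lp.ext (hadm.2.coeFn_toLp.trans hae)

end Weighted

/-! ### The matrix operator -/

section MatrixOperator

variable {a : ℝ → ℝ}

theorem exists_opMatrix_eq (ha : IsDegenerateCoefficient a) (U : (opMatrix ha).domain) :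
    ∃ (u v : H2w a) (hu : u ∈ (opA a).domain),
      (U : H0 a) = WithLp.toLp 2 (u, H2w.toL2w v) ∧
        opMatrix ha U = WithLp.toLp 2 (v, -opA a ⟨u, hu⟩) := by
  refine ⟨(U : H0 a).fst, domainSnd ha U, U.2.1, ?_, rfl⟩
  exact congrArg (fun z => WithLp.toLp 2 ((U : H0 a).fst, z)) (toL2w_domainSnd ha U).symm

/-- The two contributions to `⟨𝒜 U, U⟩` cancel by the Gauss–Green formula. -/
theorem inner_opMatrix_self (ha : IsDegenerateCoefficient a) (U : (opMatrix ha).domain) :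
    inner ℝ (opMatrix ha U) (U : H0 a) = (0 : ℝ) := by
  obtain ⟨u, v, hu, e1, e2⟩ := exists_opMatrix_eq ha U
  have h := (mem_graph_opA_iff ha u _).1 ⟨hu, rfl⟩ v
  rw [e1, e2, WithLp.prod_inner_apply]
  simp only [inner_neg_left]
  rw [real_inner_comm, h, add_neg_cancel]

theorem isNonpositive_opMatrix (ha : IsDegenerateCoefficient a) : IsNonpositive (opMatrix ha) :=
  fun U => (inner_opMatrix_self ha U).le

/-- The Lax–Milgram theorem for `1 + c J* J`. -/
theorem exists_add_smul_adjoint_apply_eq {V H : Type*} [NormedAddCommGroup V]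
    [InnerProductSpace ℝ V] [CompleteSpace V] [NormedAddCommGroup H] [InnerProductSpace ℝ H]
    [CompleteSpace H] (J : V →L[ℝ] H) {c : ℝ} (hc : 0 ≤ c) (y : V) :
    ∃ u, u + c • ContinuousLinearMap.adjoint J (J u) = y := by
  let T : V →L[ℝ] V := 1 + c • (ContinuousLinearMap.adjoint J).comp J
  have hT : ∀ u, T u = u + c • ContinuousLinearMap.adjoint J (J u) := fun u => rfl
  have hco : IsCoercive ((innerSL ℝ).comp T : V →L[ℝ] V →L[ℝ] ℝ) := by
    refine ⟨1, one_pos, fun u => ?_⟩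
    have : ((innerSL ℝ).comp T : V →L[ℝ] V →L[ℝ] ℝ) u u = ‖u‖ * ‖u‖ + c * (‖J u‖ * ‖J u‖) := by
      change inner ℝ (T u) u = _
      rw [hT, inner_add_left, real_inner_smul_left, ContinuousLinearMap.adjoint_inner_left,
        real_inner_self_eq_norm_mul_norm, real_inner_self_eq_norm_mul_norm]
    rw [this, one_mul]
    have := mul_nonneg hc (mul_self_nonneg ‖J u‖)
    linarith
  refine ⟨hco.continuousLinearEquivOfBilin.symm y, ?_⟩
  rw [← hT]
  refine ext_inner_right ℝ fun w => ?_
  have h := hco.continuousLinearEquivOfBilin_apply (hco.continuousLinearEquivOfBilin.symm y) w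
  rw [ContinuousLinearEquiv.apply_symm_apply] at h
  exact h.symm

/-- Eliminating `v = l u - f` from `l U - 𝒜 U = (f, g)` leaves `l² u + A u = g + l f`, which in
weak form reads `u + l² J* J u = J* (g + l f)` with `J` the inclusion `H²_{1/a} → L²_{1/a}`. -/
theorem exists_smul_sub_opMatrix_eq (ha : IsDegenerateCoefficient a) {l : ℝ} (F : H0 a) :
    ∃ U : (opMatrix ha).domain, l • (U : H0 a) - opMatrix ha U = F := by
  have hcomplete := H2w.completeSpace ha
  obtain ⟨f, g⟩ := F
  set J := H2w.toL2wCLM ha with hJ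
  obtain ⟨u, hu⟩ := exists_add_smul_adjoint_apply_eq J (sq_nonneg l)
    (ContinuousLinearMap.adjoint J (g + l • J f))
  have hk : ∀ v : H2w a,
      inner ℝ u v = (inner ℝ (g - l • H2w.toL2w (l • u - f)) (H2w.toL2w v) : ℝ) := by
    intro v
    have e : g - l • H2w.toL2w (l • u - f) = g + l • J f - l ^ 2 • J u := by
      simp only [hJ, H2w.toL2wCLM_apply, map_sub, map_smul]
      module
    rw [e, ← H2w.toL2wCLM_apply ha, ← hJ, ← ContinuousLinearMap.adjoint_inner_left, map_sub,
      map_smul, ← hu, add_sub_cancel_right]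
  obtain ⟨hmem, hA⟩ := (mem_graph_opA_iff ha u _).2 hk
  obtain ⟨hU, e⟩ := opMatrix_apply ha hmem (l • u - f)
  refine ⟨⟨_, hU⟩, ?_⟩
  rw [e, hA, ← WithLp.toLp_smul, ← WithLp.toLp_sub]
  congr 1
  ext1 <;> simp

theorem dense_domain_opMatrix (ha : IsDegenerateCoefficient a) :
    Dense ((opMatrix ha).domain : Set (H0 a)) := by
  have hcomplete := H2w.completeSpace ha
  rw [Submodule.dense_iff_topologicalClosure_eq_top, Submodule.topologicalClosure_eq_top_iff,
    Submodule.eq_bot_iff]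
  rintro ⟨p, q⟩ h
  rw [Submodule.mem_orthogonal'] at h
  set J := H2w.toL2wCLM ha with hJ
  have hp : p = 0 := by
    -- `J* J p` lies in the domain of `A`
    obtain ⟨hmem, -⟩ := (mem_graph_opA_iff ha (ContinuousLinearMap.adjoint J (J p)) (J p)).2
      fun v => ContinuousLinearMap.adjoint_inner_left J v (J p)
    have h1 := h _ (opMatrix_apply ha hmem 0).1
    rw [WithLp.prod_inner_apply] at h1
    simp only [map_zero, inner_zero_right, add_zero] at h1
    rw [ContinuousLinearMap.adjoint_inner_right, inner_self_eq_zero] at h1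
    exact H2w.toL2w_injective ha (h1.trans (map_zero _).symm)
  have hq : q = 0 := H2w.eq_zero_of_inner_toL2w ha q fun v => by
    have h1 := h _ (opMatrix_apply ha (opA a).domain.zero_mem v).1
    rw [WithLp.prod_inner_apply] at h1
    simpa using h1
  rw [hp, hq]
  rfl

end MatrixOperator

end DegenerateBeam

theorem mainTheorem6 (a : ℝ → ℝ) (ha : DegenerateBeam.IsDegenerateCoefficient a) :
    DegenerateBeam.IsNonpositive (DegenerateBeam.opMatrix ha) ∧
    DegenerateBeam.IsDissipative (DegenerateBeam.opMatrix ha) ∧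
    Dense ((DegenerateBeam.opMatrix ha).domain : Set (DegenerateBeam.H0 a)) ∧
    (∀ F : DegenerateBeam.H0 a, ∃ U : (DegenerateBeam.opMatrix ha).domain,
      (U : DegenerateBeam.H0 a) - DegenerateBeam.opMatrix ha U = F) ∧
    ∃ S : ℝ≥0 → DegenerateBeam.H0 a →L[ℝ] DegenerateBeam.H0 a,
      DegenerateBeam.IsContractionSemigroup S ∧
      DegenerateBeam.IsGenerator (DegenerateBeam.opMatrix ha) S := by
  have hcomplete := DegenerateBeam.H2w.completeSpace ha
  have hnonpos := DegenerateBeam.isNonpositive_opMatrix ha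
  have hdense := DegenerateBeam.dense_domain_opMatrix ha
  refine ⟨hnonpos, hnonpos.isDissipative, hdense, fun F => ?_,
    hnonpos.exists_contractionSemigroup hdense
      fun l _ F => DegenerateBeam.exists_smul_sub_opMatrix_eq ha F⟩
  simpa using DegenerateBeam.exists_smul_sub_opMatrix_eq ha (l := 1) F
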